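/- Let $\alpha\in[0,1]$. Let $T_\alpha$ be given by $T_\alpha(0)=0$ and $T_\alpha(x)=\frac{\epsilon(x)}{x}-c_\alpha(x)$ for $x\neq0$, where $\epsilon(x)=\operatorname{sgn}(x)$ and $c_\alpha(x)=\left\lfloor \frac1{|x|}+1-\alpha\right\rfloor$. The unfolded Wilton function $\tilde W_\alpha$ is the $1$-periodic function with $$\tilde W_\alpha(x)=\sum_{j\ge0}(-1)^j\Big(\prod_{i=0}^{j-1}|T_\alpha^i(x)|\Big)\log\frac1{|T_\alpha^j(x)|}\qquad\text{for a.e. }x\in[\alpha-1,\alpha).$$ For a function $w$ that is integrable on an open interval around $\xi$, the point $\xi$ is a singularity of type A if $\frac1{|h|}\int_\xi^{\xi+h}w(t)\,dt$ tends to $+\infty$, or tends to $-\infty$, as $h\to0$ (two-sided limit); it is a singularity of type B if the same holds for $\frac1h\int_\xi^{\xi+h}w(t)\,dt$. (Being of type A or B includes integrability of $w$ near $\xi$.) For $n\in\mathbb N=\{0,1,2,\dots\}$ put $$M_{\alpha,x,n}=\prod_{i=0}^{n-1}\begin{pmatrix}0&\epsilon(T_\alpha^i(x))\\1&c_\alpha(T_\alpha^i(x))\end{pmatrix}$$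 (factors ordered from left to right), defined when $T_\alpha^i(x)\ne0$ for all $i<n$. A parameter $\alpha\in(0,1]$ satisfies $(n,m)_{\rm alg}$ if $M_{\alpha,\alpha,n}$ and $M_{\alpha,\alpha-1,m}$ are defined and $$M_{\alpha,\alpha,n}=\begin{pmatrix}1&1\\0&1\end{pmatrix}M_{\alpha,\alpha-1,m}\begin{pmatrix}-1&0\\1&1\end{pmatrix}.$$ A matching interval with exponents $(n,m)$ is a connected component of the interior, relative to $(0,1]$, of the set of parameters satisfying $(n,m)_{\rm alg}$; its index is $m-n$. **Theorem.** Let $\alpha\in[0,1]$ and $\xi\in[\alpha-1,\alpha)\cap\mathbb Q$. (i) If $\{\alpha,\alpha-1\}\cap\{T_\alpha^k(\xi):k\in\mathbb N\}=\emptyset$, then $\xi$ is a type B singularity of $\tilde W_\alpha$. (ii) Otherwise $\alpha\in\mathbb Q$, and $\xi$ is a type B singularity of $\tilde W_\alpha$ if and only if $\alpha$ belongs to a matching interval of even index; if $\alpha$ belongs to a matching interval of odd index, then $\xi$ is a type A singularity of $\tilde W_\alpha$. -/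

import Mathlib

open Set Filter Topology MeasureTheory

noncomputable section

namespace AlphaCF

/-- The sign `ε(x) ∈ {-1, 0, 1}` of `x`, as an integer. -/
def eps (x : ℝ) : ℤ := ((SignType.sign x : SignType) : ℤ)

/-- The digit `c_α(x) = ⌊1/|x| + 1 - α⌋` (meaningful for `x ≠ 0`). -/
def digit (α x : ℝ) : ℤ := ⌊1 / |x| + 1 - α⌋

/-- The unfolded `α`-continued fraction map: `T_α(0) = 0` and `T_α(x) = ε(x)/x - c_α(x)` for
`x ≠ 0`. It is given by the formula on all of `ℝ`, because the matching condition also uses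
the orbit of the right endpoint `α` of `[α - 1, α)`. -/
def T (α x : ℝ) : ℝ := if x = 0 then 0 else (eps x : ℝ) / x - (digit α x : ℝ)

/-- The product `|x| |T_α x| ⋯ |T_α^{j-1} x|` of the first `j` absolute values along the orbit
(equal to `1` for `j = 0`). -/
def betaProd (α x : ℝ) (j : ℕ) : ℝ := ∏ i ∈ Finset.range j, |(T α)^[i] x|

/-- The Wilton series on `[α - 1, α)`, summed as the limit of its partial sums in the natural
order (so that conditional convergence is allowed). Its value at points where the series does not
converge, or at rational points, is immaterial: only integrals of the function are used. -/
def wiltonSeries (α x : ℝ) : ℝ :=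
  ∑'[SummationFilter.conditional ℕ] j : ℕ,
    (-1 : ℝ) ^ j * betaProd α x j * Real.log (1 / |(T α)^[j] x|)

/-- The unfolded Wilton function: the `1`-periodic function that is given by the Wilton
series on `[α - 1, α)`; the point `x - ⌊x + 1 - α⌋` is the representative of `x` modulo `1` there. -/
def wilton (α x : ℝ) : ℝ := wiltonSeries α (x - (⌊x + 1 - α⌋ : ℝ))

/-- Type A singularity: `w` is integrable on an open interval around `ξ`, and
`(1/|h|) ∫_ξ^{ξ+h} w` tends to `+∞`, or to `-∞`, as `h → 0` (from both sides). -/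
def IsTypeA (w : ℝ → ℝ) (ξ : ℝ) : Prop :=
  (∃ a b : ℝ, ξ ∈ Ioo a b ∧ IntegrableOn w (Ioo a b)) ∧
  (Tendsto (fun h : ℝ => (1 / |h|) * ∫ t in ξ..(ξ + h), w t) (𝓝[≠] 0) atTop ∨
   Tendsto (fun h : ℝ => (1 / |h|) * ∫ t in ξ..(ξ + h), w t) (𝓝[≠] 0) atBot)

/-- Type B singularity: as type A, with `1/h` in place of `1/|h|`. -/
def IsTypeB (w : ℝ → ℝ) (ξ : ℝ) : Prop :=
  (∃ a b : ℝ, ξ ∈ Ioo a b ∧ IntegrableOn w (Ioo a b)) ∧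
  (Tendsto (fun h : ℝ => (1 / h) * ∫ t in ξ..(ξ + h), w t) (𝓝[≠] 0) atTop ∨
   Tendsto (fun h : ℝ => (1 / h) * ∫ t in ξ..(ξ + h), w t) (𝓝[≠] 0) atBot)

/-- The matrix `M_{α,x,n}`, the product over `i < n` of the matrices
`(0, ε(T_α^i x); 1, c_α(T_α^i x))`, in this order. -/
def cfMatrix (α x : ℝ) : ℕ → Matrix (Fin 2) (Fin 2) ℤ
  | 0 => 1
  | n + 1 => cfMatrix α x n * !![0, eps ((T α)^[n] x); 1, digit α ((T α)^[n] x)]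

/-- The algebraic matching condition `(n, m)_alg`. The first two clauses say that the digits
entering the two matrices are defined, i.e. that neither orbit reaches `0` too early. -/
def AlgMatching (n m : ℕ) (α : ℝ) : Prop :=
  (∀ i < n, (T α)^[i] α ≠ 0) ∧ (∀ i < m, (T α)^[i] (α - 1) ≠ 0) ∧
  cfMatrix α α n = !![1, 1; 0, 1] * cfMatrix α (α - 1) m * !![-1, 0; 1, 1]

/-- The interior, relative to `(0, 1]`, of the set of parameters satisfying `(n, m)_alg`. -/
def matchingInterior (n m : ℕ) : Set ℝ :=
  {x | x ∈ Ioc (0 : ℝ) 1 ∧ ∀ᶠ y in 𝓝[Ioc (0 : ℝ) 1] x, AlgMatching n m y}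

/-- `J` is a matching interval with matching exponents `(n, m)`: a connected component of the
(relatively) open set of parameters around which `(n, m)_alg` holds. Equivalently, `J` is a maximal
relatively open subinterval of `(0, 1]` all of whose points satisfy `(n, m)_alg`. -/
def IsMatchingInterval (n m : ℕ) (J : Set ℝ) : Prop :=
  ∃ x ∈ matchingInterior n m, J = connectedComponentIn (matchingInterior n m) x

/-- `α` belongs to a matching interval whose matching index `m - n` is even. -/
def InEvenMatchingInterval (α : ℝ) : Prop :=
  ∃ (J : Set ℝ) (n m : ℕ), IsMatchingInterval n m J ∧ α ∈ J ∧ Even ((m : ℤ) - (n : ℤ))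

/-- `α` belongs to a matching interval whose matching index `m - n` is odd. -/
def InOddMatchingInterval (α : ℝ) : Prop :=
  ∃ (J : Set ℝ) (n m : ℕ), IsMatchingInterval n m J ∧ α ∈ J ∧ Odd ((m : ℤ) - (n : ℤ))

end AlphaCF

end

noncomputable section

namespace AlphaCF

theorem eps_div {x : ℝ} (hx : x ≠ 0) : (eps x : ℝ) / x = 1 / |x| := by
  rcases lt_or_gt_of_ne hx with h | h
  · simp [eps, sign_neg h, abs_of_neg h, div_neg, neg_div]
  · simp [eps, sign_pos h, abs_of_pos h]

theorem eps_of_pos {x : ℝ} (h : 0 < x) : eps x = 1 := by simp [eps, sign_pos h]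

theorem eps_of_neg {x : ℝ} (h : x < 0) : eps x = -1 := by simp [eps, sign_neg h]

theorem T_zero (α : ℝ) : T α 0 = 0 := by simp [T]

theorem T_of_ne {α x : ℝ} (hx : x ≠ 0) : T α x = 1 / |x| - (digit α x : ℝ) := by
  rw [T, if_neg hx, eps_div hx]

theorem T_mem {α x : ℝ} (hx : x ≠ 0) : T α x ∈ Ico (α - 1) α := by
  rw [T_of_ne hx, digit]
  have h1 := Int.floor_le (1 / |x| + 1 - α)
  have h2 := Int.lt_floor_add_one (1 / |x| + 1 - α)
  constructor <;> linarith

theorem T_mapsTo (α : ℝ) : MapsTo (T α) (Ico (α - 1) α) (Ico (α - 1) α) := by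
  intro x hx
  rcases eq_or_ne x 0 with rfl | h
  · rwa [T_zero]
  · exact T_mem h

theorem iterate_mem {α x : ℝ} (hx : x ∈ Ico (α - 1) α) (n : ℕ) :
    (T α)^[n] x ∈ Ico (α - 1) α := (T_mapsTo α).iterate n hx

theorem digit_eq {α x : ℝ} {c : ℤ} (h : 1 / |x| - c ∈ Ico (α - 1) α) : digit α x = c := by
  rw [digit, Int.floor_eq_iff]
  constructor <;> linarith [h.1, h.2]

theorem T_eq {α x : ℝ} {c : ℤ} (hx : x ≠ 0) (h : 1 / |x| - c ∈ Ico (α - 1) α) :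
    T α x = 1 / |x| - c := by
  rw [T_of_ne hx, digit_eq h]

theorem T_eq_T {α x y : ℝ} {c : ℤ} (hx : x ≠ 0) (hy : y ≠ 0) (h : 1 / |x| = 1 / |y| + c) :
    T α x = T α y := by
  have := T_mem (α := α) hy
  rw [T_of_ne hy] at this
  rw [T_eq (c := digit α y + c) hx, T_of_ne hy] <;> push_cast
  · rw [h]; ring
  · rw [h]; convert this using 1; ring

theorem iterate_zero_of_le {α x : ℝ} {k n : ℕ} (hk : (T α)^[k] x = 0) (h : k ≤ n) :
    (T α)^[n] x = 0 := by
  obtain ⟨r, rfl⟩ := Nat.exists_eq_add_of_le' h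
  rw [Function.iterate_add_apply, hk]
  exact Function.iterate_fixed (T_zero α) r

/-- `x` is a rational number that can be written with a denominator at most `N`. -/
def DenLE (N : ℕ) (x : ℝ) : Prop := ∃ (p : ℤ) (q : ℕ), 0 < q ∧ q ≤ N ∧ x = p / q

theorem DenLE.mono {N M : ℕ} {x : ℝ} (h : DenLE N x) (hNM : N ≤ M) : DenLE M x := by
  obtain ⟨p, q, h1, h2, h3⟩ := h
  exact ⟨p, q, h1, h2.trans hNM, h3⟩

theorem DenLE.neg {N : ℕ} {x : ℝ} (h : DenLE N x) : DenLE N (-x) := by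
  obtain ⟨p, q, h1, h2, h3⟩ := h
  exact ⟨-p, q, h1, h2, by rw [h3]; push_cast; ring⟩

theorem DenLE.add_int {N : ℕ} {x : ℝ} (h : DenLE N x) (c : ℤ) : DenLE N (x + c) := by
  obtain ⟨p, q, h1, h2, h3⟩ := h
  refine ⟨p + c * q, q, h1, h2, ?_⟩
  have : (q : ℝ) ≠ 0 := by positivity
  rw [h3]; push_cast; field_simp

theorem DenLE.one_div_abs {N : ℕ} {x : ℝ} (h : DenLE (N + 1) x) (hx : x ≠ 0) (h1 : |x| < 1) :
    DenLE N (1 / |x|) := by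
  obtain ⟨p, q, hq, hqN, rfl⟩ := h
  have hq' : (0 : ℝ) < q := by exact_mod_cast hq
  have hp : p ≠ 0 := by rintro rfl; simp at hx
  rw [abs_div, abs_of_pos hq', div_lt_one hq'] at h1
  have hpa : (p.natAbs : ℝ) = |(p : ℝ)| := by rw [Nat.cast_natAbs]; push_cast; rfl
  refine ⟨q, p.natAbs, Int.natAbs_pos.mpr hp, ?_, ?_⟩
  · rw [← hpa] at h1
    have : p.natAbs < q := by exact_mod_cast h1
    omega
  · rw [hpa, abs_div, abs_of_pos hq']
    push_cast
    rw [one_div_div]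

theorem DenLE.map_T {N : ℕ} {α x : ℝ} (h : DenLE (N + 1) x) (hx : x ≠ 0) (h1 : |x| < 1) :
    DenLE N (T α x) := by
  rw [T_of_ne hx]
  simpa [sub_eq_add_neg] using (h.one_div_abs hx h1).add_int (-digit α x)

theorem not_denLE_zero (x : ℝ) : ¬ DenLE 0 x := by
  rintro ⟨p, q, h1, h2, -⟩; omega

theorem DenLE.eq_zero {x : ℝ} (h : DenLE 1 x) (h1 : |x| < 1) : x = 0 := by
  by_contra hx
  exact not_denLE_zero _ (h.one_div_abs hx h1)

theorem denLE_of_rat (r : ℚ) : DenLE r.den (r : ℝ) :=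
  ⟨r.num, r.den, r.pos, le_rfl, Rat.cast_def r⟩

theorem abs_lt_one {α x : ℝ} (h0 : 0 < α) (h1 : α ≤ 1) (hx : x ∈ Ico (α - 1) α) : |x| < 1 := by
  rw [abs_lt]; constructor <;> linarith [hx.1, hx.2]

/-- Rational orbits end at `0`, or at `-1` (which is possible for `α = 0` only). -/
theorem exists_iterate_eq {α : ℝ} (hα : α ∈ Icc (0 : ℝ) 1) (N : ℕ) :
    ∀ x ∈ Ico (α - 1) α, DenLE N x → ∃ k, (T α)^[k] x = 0 ∨ (T α)^[k] x = -1 := by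
  induction N with
  | zero => exact fun x _ h => (not_denLE_zero x h).elim
  | succ N ih =>
    intro x hx h
    by_cases h0 : x = 0
    · exact ⟨0, Or.inl h0⟩
    by_cases h1 : x = -1
    · exact ⟨0, Or.inr h1⟩
    have : |x| < 1 := by
      rw [abs_lt]
      exact ⟨lt_of_le_of_ne (by linarith [hx.1, hα.1]) (Ne.symm h1), by linarith [hx.2, hα.2]⟩
    obtain ⟨k, hk⟩ := ih _ (T_mem (α := α) h0) (h.map_T h0 this)
    exact ⟨k + 1, by simpa [Function.iterate_succ_apply] using hk⟩

theorem exists_iterate_eq_zero {α x : ℝ} (h0 : 0 < α) (h1 : α ≤ 1) (hx : x ∈ Ico (α - 1) α)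
    (hxQ : x ∈ range ((↑) : ℚ → ℝ)) : ∃ k, (T α)^[k] x = 0 := by
  obtain ⟨r, rfl⟩ := hxQ
  obtain ⟨k, hk | hk⟩ := exists_iterate_eq ⟨h0.le, h1⟩ _ _ hx (denLE_of_rat r)
  · exact ⟨k, hk⟩
  · have := iterate_mem hx k
    rw [hk] at this
    linarith [this.1]

theorem T_rat {α x : ℝ} (hx : x ∈ range ((↑) : ℚ → ℝ)) : T α x ∈ range ((↑) : ℚ → ℝ) := by
  obtain ⟨r, rfl⟩ := hx
  by_cases h : (r : ℝ) = 0
  · exact ⟨0, by rw [h, T_zero]; simp⟩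
  · rw [T_of_ne h]
    exact ⟨1 / |r| - digit α r, by push_cast; rfl⟩

theorem iterate_rat {α x : ℝ} (hx : x ∈ range ((↑) : ℚ → ℝ)) (n : ℕ) :
    (T α)^[n] x ∈ range ((↑) : ℚ → ℝ) := by
  induction n with
  | zero => exact hx
  | succ n ih => rw [Function.iterate_succ_apply']; exact T_rat ih

/-- The iterates of a rational number with denominator at most `N + 1` have denominator
at most `N`. -/
theorem DenLE.iterate {α x : ℝ} {N : ℕ} (h0 : 0 < α) (h1 : α < 1) (hN : 1 ≤ N)
    (h : DenLE (N + 1) x) (hx : x ∈ Icc (α - 1) α) (n : ℕ) : DenLE N ((T α)^[n + 1] x) := by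
  have key : ∀ y, DenLE (N + 1) y → y ∈ Icc (α - 1) α → DenLE N (T α y) ∧
      T α y ∈ Icc (α - 1) α := by
    intro y hy hyI
    by_cases hy0 : y = 0
    · subst hy0
      rw [T_zero]
      exact ⟨⟨0, 1, one_pos, hN, by simp⟩, hyI⟩
    · exact ⟨hy.map_T hy0 (by rw [abs_lt]; constructor <;> linarith [hyI.1, hyI.2]),
        Ico_subset_Icc_self (T_mem hy0)⟩
  have : ∀ n, DenLE N ((T α)^[n + 1] x) ∧ (T α)^[n + 1] x ∈ Icc (α - 1) α := by
    intro n
    induction n with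
    | zero => exact key x h hx
    | succ n ih =>
      rw [Function.iterate_succ_apply']
      exact key _ (ih.1.mono (Nat.le_succ N)) ih.2
  exact (this n).1

/-- For rational `α ∈ (0, 1)` the orbits of the endpoints `α` and `α - 1` do not return to
`α - 1`. -/
theorem iterate_endpoint_ne {α x : ℝ} (h0 : 0 < α) (h1 : α < 1) (hαQ : α ∈ range ((↑) : ℚ → ℝ))
    (hx : x = α ∨ x = α - 1) (n : ℕ) : (T α)^[n + 1] x ≠ α - 1 := by
  classical
  have hex : ∃ N, DenLE N α := by
    obtain ⟨r, rfl⟩ := hαQ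
    exact ⟨_, denLE_of_rat r⟩
  have hspec := Nat.find_spec hex
  have hmin := fun m => Nat.find_min (m := m) hex
  generalize Nat.find hex = N at hspec hmin
  match N, hspec, hmin with
  | 0, h, _ => exact (not_denLE_zero _ h).elim
  | 1, h, _ => exact absurd (h.eq_zero (by rw [abs_of_pos h0]; exact h1)) h0.ne'
  | N + 2, h, hmin =>
    intro hc
    have hd : DenLE (N + 1 + 1) x := by
      rcases hx with rfl | rfl
      · exact h
      · simpa [sub_eq_add_neg] using h.add_int (-1)
    have hxI : x ∈ Icc (α - 1) α := by
      rcases hx with rfl | rfl <;> constructor <;> linarith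
    have := hd.iterate h0 h1 (by omega) hxI n
    rw [hc] at this
    refine hmin (N + 1) (by omega) ?_
    simpa using this.add_int 1

/-- The matrix of a single step of the continued fraction algorithm. -/
def stepMatrix (α x : ℝ) : Matrix (Fin 2) (Fin 2) ℤ := !![0, eps x; 1, digit α x]

theorem cfMatrix_zero (α x : ℝ) : cfMatrix α x 0 = 1 := rfl

theorem cfMatrix_succ (α x : ℝ) (n : ℕ) :
    cfMatrix α x (n + 1) = cfMatrix α x n * stepMatrix α ((T α)^[n] x) := rfl

theorem cfMatrix_one (α x : ℝ) : cfMatrix α x 1 = stepMatrix α x := by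
  rw [cfMatrix_succ, cfMatrix_zero, one_mul]; rfl

theorem cfMatrix_add (α x : ℝ) (j m : ℕ) :
    cfMatrix α x (j + m) = cfMatrix α x j * cfMatrix α ((T α)^[j] x) m := by
  induction m with
  | zero => rw [cfMatrix_zero, mul_one, add_zero]
  | succ m ih =>
    rw [← add_assoc, cfMatrix_succ, ih, cfMatrix_succ, mul_assoc, ← Function.iterate_add_apply,
      add_comm m j]

theorem eps_sq {x : ℝ} (hx : x ≠ 0) : eps x * eps x = 1 := by
  rcases lt_or_gt_of_ne hx with h | h
  · simp [eps_of_neg h]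
  · simp [eps_of_pos h]

theorem cfMatrix_det_sq {α x : ℝ} {n : ℕ} (h : ∀ i < n, (T α)^[i] x ≠ 0) :
    (cfMatrix α x n).det * (cfMatrix α x n).det = 1 := by
  induction n with
  | zero => simp [cfMatrix_zero]
  | succ n ih =>
    have h1 := ih fun i hi => h i (by omega)
    have h2 := eps_sq (h n (by omega))
    have h3 : (stepMatrix α ((T α)^[n] x)).det = -eps ((T α)^[n] x) := by
      simp [stepMatrix, Matrix.det_fin_two]
    rw [cfMatrix_succ, Matrix.det_mul, h3]
    linear_combination (eps ((T α)^[n] x) * eps ((T α)^[n] x)) * h1 + h2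

/-- The Möbius action of `cfMatrix α x n` maps `T^n x` back to `x`. -/
theorem cfMatrix_apply {α x : ℝ} {n : ℕ} (h : ∀ i < n, (T α)^[i] x ≠ 0) :
    ∃ κ : ℝ, 0 < κ ∧
      (cfMatrix α x n 0 0 : ℝ) * (T α)^[n] x + cfMatrix α x n 0 1 = κ * x ∧
      (cfMatrix α x n 1 0 : ℝ) * (T α)^[n] x + cfMatrix α x n 1 1 = κ := by
  induction n with
  | zero => exact ⟨1, one_pos, by simp [cfMatrix_zero], by simp [cfMatrix_zero]⟩
  | succ n ih =>
    obtain ⟨κ, hκ, e1, e2⟩ := ih fun i hi => h i (by omega)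
    have hn := h n (by omega)
    have hT : T α ((T α)^[n] x) = _ := T_of_ne hn
    rw [Function.iterate_succ_apply', cfMatrix_succ]
    generalize (T α)^[n] x = y at *
    have hy : 0 < |y| := abs_pos.mpr hn
    have hey : (eps y : ℝ) = y / |y| := by
      have := eps_div hn
      field_simp at this ⊢
      exact this
    refine ⟨κ / |y|, div_pos hκ hy, ?_, ?_⟩
    · simp only [stepMatrix, Matrix.mul_apply, Fin.sum_univ_two, Matrix.of_apply,
        Matrix.cons_val', Matrix.cons_val_zero, Matrix.cons_val_one, Matrix.cons_val_fin_one]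
      push_cast
      rw [hT, hey]
      field_simp
      linear_combination e1
    · simp only [stepMatrix, Matrix.mul_apply, Fin.sum_univ_two, Matrix.of_apply,
        Matrix.cons_val', Matrix.cons_val_zero, Matrix.cons_val_one, Matrix.cons_val_fin_one]
      push_cast
      rw [hT, hey]
      field_simp
      linear_combination e2

theorem AlgMatching.relation {n m : ℕ} {α : ℝ} (h : AlgMatching n m α) :
    0 < 1 + (T α)^[n] α ∧
      (1 + (T α)^[n] α) * (T α)^[m] (α - 1) = -(T α)^[n] α := by
  obtain ⟨hn, hm, hM⟩ := h
  obtain ⟨κ, hκ, e1, e2⟩ := cfMatrix_apply hn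
  obtain ⟨κ', hκ', f1, f2⟩ := cfMatrix_apply hm
  have hdet := cfMatrix_det_sq hm
  rw [hM] at e1 e2
  generalize cfMatrix α (α - 1) m = M at *
  generalize (T α)^[n] α = a at *
  generalize (T α)^[m] (α - 1) = b at *
  rw [Matrix.det_fin_two] at hdet
  simp only [Matrix.mul_apply, Fin.sum_univ_two, Matrix.of_apply,
    Matrix.cons_val', Matrix.cons_val_zero, Matrix.cons_val_one, Matrix.cons_val_fin_one] at e1 e2
  push_cast at e1 e2
  generalize M 0 0 = m00 at *
  generalize M 0 1 = m01 at *
  generalize M 1 0 = m10 at *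
  generalize M 1 1 = m11 at *
  have hd : ((m00 : ℝ) * m11 - m01 * m10) * (m00 * m11 - m01 * m10) = 1 := by exact_mod_cast hdet
  set d : ℝ := (m00 : ℝ) * m11 - m01 * m10 with hd'
  have E1 : ((m00 : ℝ) + m10) * (κ * b + κ' * a) + (m01 + m11) * (κ - κ' * (1 + a)) = 0 := by
    linear_combination κ * f1 + κ * f2 - κ' * e1
  have E2 : (m10 : ℝ) * (κ * b + κ' * a) + m11 * (κ - κ' * (1 + a)) = 0 := by
    linear_combination κ * f2 - κ' * e2
  have X : κ * b + κ' * a = 0 := by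
    linear_combination d * (m11 * E1 - (m01 + m11) * E2) - (κ * b + κ' * a) * hd
  have Y : κ - κ' * (1 + a) = 0 := by
    linear_combination d * (-m10 * E1 + (m00 + m10) * E2) - (κ - κ' * (1 + a)) * hd
  have hpos : 0 < 1 + a := by
    by_contra hc
    have := mul_nonpos_of_nonneg_of_nonpos hκ'.le (not_lt.mp hc)
    linarith
  refine ⟨hpos, mul_left_cancel₀ hκ'.ne' ?_⟩
  linear_combination X - b * Y

/-- The orbit of `x` reaches `0` for the first time after `k` steps. -/
def FirstZero (α x : ℝ) (k : ℕ) : Prop := (T α)^[k] x = 0 ∧ ∀ i < k, (T α)^[i] x ≠ 0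

theorem FirstZero.unique {α x : ℝ} {k l : ℕ} (hk : FirstZero α x k) (hl : FirstZero α x l) :
    k = l := by
  rcases lt_trichotomy k l with h | h | h
  · exact (hl.2 k h hk.1).elim
  · exact h
  · exact (hk.2 l h hl.1).elim

theorem FirstZero.iterate {α x : ℝ} {k n : ℕ} (hk : FirstZero α x (n + k)) :
    FirstZero α ((T α)^[n] x) k := by
  refine ⟨by rw [← Function.iterate_add_apply, add_comm]; exact hk.1, fun i hi => ?_⟩
  rw [← Function.iterate_add_apply]
  exact hk.2 _ (by omega)

theorem exists_firstZero {α x : ℝ} (h : ∃ k, (T α)^[k] x = 0) : ∃ k, FirstZero α x k := by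
  classical
  exact ⟨Nat.find h, Nat.find_spec h, fun i hi => Nat.find_min h hi⟩

theorem AlgMatching.index_eq {n m n₀ m₀ : ℕ} {α : ℝ} (h : AlgMatching n m α)
    (hn : FirstZero α α n₀) (hm : FirstZero α (α - 1) m₀) : n₀ + m = m₀ + n := by
  obtain ⟨hpos, hrel⟩ := h.relation
  have h1 : n ≤ n₀ := not_lt.mp fun hc => h.1 n₀ hc hn.1
  have h2 : m ≤ m₀ := not_lt.mp fun hc => h.2.1 m₀ hc hm.1
  obtain ⟨r, rfl⟩ := Nat.exists_eq_add_of_le h1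
  obtain ⟨s, rfl⟩ := Nat.exists_eq_add_of_le h2
  have ha := hn.iterate
  have hb := hm.iterate
  generalize (T α)^[n] α = a at *
  generalize (T α)^[m] (α - 1) = b at *
  suffices r = s by omega
  rcases eq_or_ne a 0 with rfl | ha0
  · have hb0 : b = 0 := by simpa using hrel
    subst hb0
    exact ha.unique hb
  have hb0 : b ≠ 0 := by
    rintro rfl
    apply ha0
    linarith
  have hTT : T α a = T α b := by
    have hb' : b = -a / (1 + a) := by field_simp; linarith
    rcases lt_or_gt_of_ne ha0 with h | h
    · have : 0 < b := by rw [hb']; exact div_pos (by linarith) hpos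
      refine T_eq_T (c := 1) ha0 hb0 ?_
      rw [abs_of_neg h, abs_of_pos this, hb']
      have : -a ≠ 0 := by linarith
      push_cast
      field_simp
      ring
    · have : b < 0 := by rw [hb']; exact div_neg_of_neg_of_pos (by linarith) hpos
      refine T_eq_T (c := -1) ha0 hb0 ?_
      rw [abs_of_pos h, abs_of_neg this, hb']
      push_cast
      field_simp
      ring
  cases r with
  | zero => exact (ha0 ha.1).elim
  | succ r =>
  cases s with
  | zero => exact (hb0 hb.1).elim
  | succ s =>
  rw [add_comm r, add_comm s] at *
  have ha' := ha.iterate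
  have hb'' := hb.iterate
  simp only [Function.iterate_one] at ha' hb''
  rw [hTT] at ha'
  rw [ha'.unique hb'']

/-- Continuing the expansion of `a` to the right of the matrix `La`, and that of `b` to the right
of `Lb`, one arrives at matrices that match. -/
def Matches (α : ℝ) (La : Matrix (Fin 2) (Fin 2) ℤ) (a : ℝ) (Lb : Matrix (Fin 2) (Fin 2) ℤ)
    (b : ℝ) : Prop :=
  ∃ n m : ℕ, (∀ i < n, (T α)^[i] a ≠ 0) ∧ (∀ i < m, (T α)^[i] b ≠ 0) ∧
    La * cfMatrix α a n = Lb * cfMatrix α b m * !![-1, 0; 1, 1]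

theorem Matches.symm {α a b : ℝ} {La Lb : Matrix (Fin 2) (Fin 2) ℤ} (h : Matches α La a Lb b) :
    Matches α Lb b La a := by
  obtain ⟨n, m, h1, h2, h3⟩ := h
  refine ⟨m, n, h2, h1, ?_⟩
  have : (!![-1, 0; 1, 1] : Matrix (Fin 2) (Fin 2) ℤ) * !![-1, 0; 1, 1] = 1 := by decide
  rw [h3, mul_assoc, this, mul_one]

theorem Matches.of_iterate_right {α a b : ℝ} {La Lb : Matrix (Fin 2) (Fin 2) ℤ} {j : ℕ}
    (hb : ∀ i < j, (T α)^[i] b ≠ 0) (h : Matches α La a (Lb * cfMatrix α b j) ((T α)^[j] b)) :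
    Matches α La a Lb b := by
  obtain ⟨n, m, h1, h2, h3⟩ := h
  refine ⟨n, j + m, h1, fun i hi => ?_, ?_⟩
  · rcases lt_or_ge i j with h | h
    · exact hb i h
    · obtain ⟨r, rfl⟩ := Nat.exists_eq_add_of_le' h
      rw [Function.iterate_add_apply]
      exact h2 r (by omega)
  · rw [h3, cfMatrix_add, mul_assoc Lb]

theorem Matches.of_iterate_left {α a b : ℝ} {La Lb : Matrix (Fin 2) (Fin 2) ℤ} {j : ℕ}
    (ha : ∀ i < j, (T α)^[i] a ≠ 0) (h : Matches α (La * cfMatrix α a j) ((T α)^[j] a) Lb b) :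
    Matches α La a Lb b :=
  (h.symm.of_iterate_right ha).symm

/-- A run of digits `2`, along an orbit that starts close to `-1`. -/
theorem run_of_twos {α t b : ℝ} {l : ℤ} {Lb R : Matrix (Fin 2) (Fin 2) ℤ} (h0 : 0 < α)
    (hb : b ≠ 0) (hbt : 1 / |b| = 1 + 1 / (t - 1) + l) (ht : α * (t - 1) ≤ 1)
    (hL : Lb * !![0, eps b; 1, l] = R * !![1, 0; 1, -1]) (i : ℕ)
    (hi : 1 < (1 + α) * (t - (i + 1 : ℕ))) :
    (T α)^[i + 1] b = 1 / (t - (i + 1 : ℕ)) - 1 ∧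
      Lb * cfMatrix α b (i + 1) = R * !![(i : ℤ) + 1, i + 2; 1, 1] := by
  have hmem : ∀ j : ℕ, 1 < (1 + α) * (t - (j + 1 : ℕ)) →
      1 / (t - (j + 1 : ℕ)) - 1 ∈ Ico (α - 1) α := by
    intro j hj
    have hpos : 0 < t - (j + 1 : ℕ) := by
      by_contra hc
      have := mul_nonpos_of_nonneg_of_nonpos (by linarith : (0 : ℝ) ≤ 1 + α) (not_lt.mp hc)
      linarith
    constructor
    · have : α ≤ 1 / (t - (j + 1 : ℕ)) := by
        rw [le_div_iff₀ hpos]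
        push_cast
        have : (0 : ℝ) ≤ j := Nat.cast_nonneg j
        nlinarith
      linarith
    · have : 1 / (t - (j + 1 : ℕ)) < 1 + α := by
        rwa [div_lt_iff₀ hpos]
      linarith
  induction i with
  | zero =>
    have e : 1 / |b| - ((l + 2 : ℤ) : ℝ) = 1 / (t - (0 + 1 : ℕ)) - 1 := by
      rw [hbt]; push_cast; ring
    have hm : 1 / |b| - ((l + 2 : ℤ) : ℝ) ∈ Ico (α - 1) α := by rw [e]; exact hmem 0 hi
    refine ⟨?_, ?_⟩
    · rw [Function.iterate_one, T_eq hb hm, e]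
    · rw [cfMatrix_one, stepMatrix, digit_eq hm]
      have s : (!![0, eps b; 1, l + 2] : Matrix (Fin 2) (Fin 2) ℤ) =
          !![0, eps b; 1, l] * !![1, 2; 0, 1] := by
        simp; ring
      rw [s, ← mul_assoc, hL, mul_assoc]
      simp
  | succ i ih =>
    have hs : t - (i + 1 : ℕ) = t - (i + 1 + 1 : ℕ) + 1 := by push_cast; ring
    have hpos : 0 < t - (i + 1 + 1 : ℕ) := by
      by_contra hc
      have := mul_nonpos_of_nonneg_of_nonpos (by linarith : (0 : ℝ) ≤ 1 + α) (not_lt.mp hc)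
      linarith
    obtain ⟨e1, e2⟩ := ih (by rw [hs]; nlinarith)
    have hmi := hmem (i + 1) hi
    rw [hs] at e1
    generalize hst : t - (i + 1 + 1 : ℕ) = s at *
    have hneg : 1 / (s + 1) - 1 < 0 := by
      rw [sub_neg, div_lt_one (by linarith)]; linarith
    have habs : 1 / |1 / (s + 1) - 1| = 1 + 1 / s := by
      have h' : -(1 / (s + 1) - 1) = s / (s + 1) := by field_simp; ring
      rw [abs_of_neg hneg, h']; field_simp
    have e : 1 / |1 / (s + 1) - 1| - ((2 : ℤ) : ℝ) = 1 / s - 1 := by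
      rw [habs]; push_cast; ring
    have hm : 1 / |1 / (s + 1) - 1| - ((2 : ℤ) : ℝ) ∈ Ico (α - 1) α := by rw [e]; exact hmi
    refine ⟨?_, ?_⟩
    · rw [Function.iterate_succ_apply', e1, T_eq hneg.ne hm, e]
    · rw [cfMatrix_succ, e1, stepMatrix, digit_eq hm, eps_of_neg hneg, ← mul_assoc, e2, mul_assoc]
      simp only [Matrix.mul_fin_two]
      push_cast
      ring_nf

/-- Matching from a state in which `a` and `b` have digit expansions that continue with those of
the complementary numbers `A` and `1 - A`. -/
theorem matches_of_complementary {α : ℝ} (h0 : 0 < α) (h1 : α < 1) (N : ℕ) :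
    ∀ A : ℝ, DenLE N A → α / (1 + α) ≤ A → A ≤ 1 / (1 + α) →
    ∀ (La Lb : Matrix (Fin 2) (Fin 2) ℤ) (a b : ℝ) (k l : ℤ), a ≠ 0 → b ≠ 0 →
      1 / |a| = 1 / A + k → 1 / |b| = 1 / (1 - A) + l →
      La * !![0, eps a; 1, k] = Lb * !![0, eps b; 1, l] * !![1, 0; 1, -1] →
      Matches α La a Lb b := by
  induction N with
  | zero => exact fun A h => (not_denLE_zero A h).elim
  | succ N ih =>
  have hI : (!![1, 0; 1, -1] : Matrix (Fin 2) (Fin 2) ℤ) * !![1, 0; 1, -1] = 1 := by decide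
  have key : ∀ A : ℝ, DenLE (N + 1) A → α / (1 + α) ≤ A → A ≤ 1 / 2 →
    ∀ (La Lb : Matrix (Fin 2) (Fin 2) ℤ) (a b : ℝ) (k l : ℤ), a ≠ 0 → b ≠ 0 →
      1 / |a| = 1 / A + k → 1 / |b| = 1 / (1 - A) + l →
      La * !![0, eps a; 1, k] = Lb * !![0, eps b; 1, l] * !![1, 0; 1, -1] →
      Matches α La a Lb b := by
    intro A hden hA1 hA2 La Lb a b k l ha hb hak hbl hL
    have hApos : 0 < A := lt_of_lt_of_le (by positivity) hA1
    have hdt : DenLE N (1 / A) := by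
      have := hden.one_div_abs hApos.ne' (by rw [abs_of_pos hApos]; linarith)
      rwa [abs_of_pos hApos] at this
    have ht2 : 2 ≤ 1 / A := by rw [le_div_iff₀ hApos]; linarith
    have hbt : 1 / |b| = 1 + 1 / (1 / A - 1) + l := by
      rw [hbl]
      have : (1 : ℝ) - A ≠ 0 := by linarith
      have : (1 : ℝ) / A - 1 ≠ 0 := by linarith
      have e : 1 / A - 1 = (1 - A) / A := by field_simp
      rw [e]; field_simp; ring
    have ht : α * (1 / A - 1) ≤ 1 := by
      rw [div_le_iff₀ (by linarith)] at hA1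
      have e : 1 / A - 1 = (1 - A) / A := by field_simp
      rw [e, mul_div_assoc', div_le_one hApos]
      linarith
    generalize 1 / A = t at *
    set R := La * !![0, eps a; 1, k] with hR
    have hLb : Lb * !![0, eps b; 1, l] = R * !![1, 0; 1, -1] := by
      rw [hL, mul_assoc _ !![1, 0; 1, -1], hI, mul_one]
    have hTa := T_mem (α := α) ha
    have hTa' := T_of_ne (α := α) ha
    obtain ⟨C, hC⟩ : ∃ C, digit α a = C + k := ⟨digit α a - k, by ring⟩
    rw [hC, hak] at hTa'
    have hTa2 : T α a = t - C := by rw [hTa']; push_cast; ring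
    have hC2 : 2 ≤ C := by
      have : (1 : ℝ) < C := by linarith [hTa.2]
      have : 1 < C := by exact_mod_cast this
      omega
    obtain ⟨c, rfl⟩ : ∃ c : ℕ, C = c + 2 := ⟨(C - 2).toNat, by omega⟩
    push_cast at hTa2
    have hLa : La * cfMatrix α a 1 = R * !![1, (c : ℤ) + 2; 0, 1] := by
      rw [cfMatrix_one, stepMatrix, hC, hR, mul_assoc]
      simp
    have run := run_of_twos h0 hb hbt ht hLb
    clear_value R
    have hbne : ∀ i < c + 1, (T α)^[i] b ≠ 0 := by
      intro i hi
      match i with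
      | 0 => exact hb
      | i + 1 =>
        have hic : ((i + 1 : ℕ) : ℝ) ≤ c := by exact_mod_cast (by omega : i + 1 ≤ c)
        have h3 : 1 + α ≤ t - (i + 1 : ℕ) := by linarith [hTa.1]
        have h4 : 1 < (1 + α) * (t - (i + 1 : ℕ)) := by nlinarith
        rw [(run i h4).1, sub_ne_zero]
        apply ne_of_lt
        rw [div_lt_one (by linarith)]
        linarith
    by_cases hcase : 1 < (1 + α) * (T α a + 1)
    · have := (run c (by convert hcase using 2; rw [hTa2]; push_cast; ring)).2
      refine ⟨1, c + 1, fun i hi => ?_, hbne, ?_⟩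
      · obtain rfl : i = 0 := by omega
        exact ha
      · rw [hLa, this, mul_assoc]
        congr 1
        simp
    · have hle := not_lt.mp hcase
      have hneg : T α a < 0 := by nlinarith
      have hc1 : 1 ≤ c := by
        have : (0 : ℝ) < c := by linarith
        exact_mod_cast this
      obtain ⟨c, rfl⟩ : ∃ c' : ℕ, c = c' + 1 := ⟨c - 1, by omega⟩
      have hs : t - (c + 1 : ℕ) = T α a + 2 := by rw [hTa2]; ring
      obtain ⟨e1, e2⟩ := run c (by rw [hs]; nlinarith [hTa.1])
      refine Matches.of_iterate_left (j := 1) (fun i hi => ?_)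
        (Matches.of_iterate_right (j := c + 1) (fun i hi => hbne i (by omega)) ?_)
      · obtain rfl : i = 0 := by omega
        exact ha
      rw [e1, hs, Function.iterate_one]
      have hden' : DenLE N (-T α a) := by
        rw [hTa2]
        have := (hdt.add_int (-((c : ℤ) + 3))).neg
        convert this using 1
        push_cast; ring
      rw [hLa, e2]
      generalize T α a = a' at *
      have hp : 0 < a' + 1 := by linarith [hTa.1]
      have hbn : 1 / (a' + 2) - 1 < 0 := by rw [sub_neg, div_lt_one (by linarith)]; linarith
      refine ih (-a') hden' ?_ ?_ _ _ _ _ 0 1 hneg.ne hbn.ne ?_ ?_ ?_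
      · rw [div_le_iff₀ (by linarith)]; linarith
      · rw [le_div_iff₀ (by linarith)]; nlinarith [hTa.1]
      · rw [abs_of_neg hneg]; simp
      · have e : -(1 / (a' + 2) - 1) = (a' + 1) / (a' + 2) := by
          have : a' + 2 ≠ 0 := by linarith
          field_simp; ring
        rw [abs_of_neg hbn, e, sub_neg_eq_add, add_comm 1 a']
        field_simp
        push_cast; ring
      · rw [eps_of_neg hneg, eps_of_neg hbn, mul_assoc, mul_assoc, mul_assoc]
        congr 1
        simp only [Matrix.mul_fin_two]
        push_cast
        ring_nf
  intro A hden hA1 hA2 La Lb a b k l ha hb hak hbl hL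
  by_cases hA : A ≤ 1 / 2
  · exact key A hden hA1 hA La Lb a b k l ha hb hak hbl hL
  · refine (key (1 - A) ?_ ?_ (by linarith) Lb La b a l k hb ha hbl (by simpa using hak) ?_).symm
    · simpa [sub_eq_add_neg, add_comm] using hden.neg.add_int 1
    · rw [div_le_iff₀ (by linarith)]
      rw [le_div_iff₀ (by linarith)] at hA2
      linarith
    · rw [hL, mul_assoc _ !![1, 0; 1, -1], hI, mul_one]

theorem algMatching_one_zero {α : ℝ} (h0 : 0 < α) (h1 : α ≤ 1) (h : 1 < (1 + α) * α) :
    AlgMatching 1 0 α := by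
  have hd : digit α α = 1 := by
    refine digit_eq ⟨?_, ?_⟩
    · rw [abs_of_pos h0]
      have : 1 ≤ 1 / α := by rwa [le_div_iff₀ h0, one_mul]
      push_cast
      linarith
    · rw [abs_of_pos h0]
      have : 1 / α < 1 + α := by rwa [div_lt_iff₀ h0]
      push_cast
      linarith
  refine ⟨fun i hi => ?_, fun i hi => by omega, ?_⟩
  · obtain rfl : i = 0 := by omega
    exact h0.ne'
  · rw [cfMatrix_one, cfMatrix_zero, stepMatrix, hd, eps_of_pos h0]
    decide

theorem exists_algMatching {α : ℝ} (h0 : 0 < α) (h1 : α < 1)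
    (hQ : α ∈ range ((↑) : ℚ → ℝ)) : ∃ n m, AlgMatching n m α := by
  by_cases hg : 1 < (1 + α) * α
  · exact ⟨1, 0, algMatching_one_zero h0 h1.le hg⟩
  · obtain ⟨r, hr⟩ := hQ
    have hn : α - 1 < 0 := by linarith
    obtain ⟨n, m, h2, h3, h4⟩ := matches_of_complementary h0 h1 r.den α (hr ▸ denLE_of_rat r)
      (by rw [div_le_iff₀ (by linarith)]; nlinarith)
      (by rw [le_div_iff₀ (by linarith)]; linarith) 1 !![1, 1; 0, 1] α (α - 1) 0 0 h0.ne' hn.ne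
      (by simp [abs_of_pos h0]) (by simp [abs_of_neg hn])
      (by rw [eps_of_pos h0, eps_of_neg hn]; decide)
    exact ⟨n, m, h2, h3, by rwa [one_mul] at h4⟩

/-- The matrices along an orbit that avoids the discontinuities are locally constant. -/
theorem eventually_cfMatrix_eq {α : ℝ} {f : ℝ → ℝ} (hf : ContinuousAt f α) (n : ℕ)
    (h0 : ∀ i < n, (T α)^[i] (f α) ≠ 0) (h1 : ∀ i < n, (T α)^[i + 1] (f α) ≠ α - 1) :
    ContinuousAt (fun y => (T y)^[n] (f y)) α ∧ ∀ᶠ y in 𝓝 α,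
      (∀ i < n, (T y)^[i] (f y) ≠ 0) ∧ cfMatrix y (f y) n = cfMatrix α (f α) n := by
  induction n with
  | zero => exact ⟨hf, Eventually.of_forall fun y => ⟨fun i hi => by omega, rfl⟩⟩
  | succ n ih =>
    obtain ⟨hc, he⟩ := ih (fun i hi => h0 i (by omega)) (fun i hi => h1 i (by omega))
    have hn := h0 n (by omega)
    have hT := h1 n (by omega)
    rw [Function.iterate_succ_apply'] at hT
    have hcv : ContinuousAt (fun y => 1 / |(T y)^[n] (f y)| + 1 - y) α := by
      have : |(T α)^[n] (f α)| ≠ 0 := abs_ne_zero.mpr hn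
      exact ((continuousAt_const.div hc.abs this).add continuousAt_const).sub continuousAt_id
    have hdig : ∀ᶠ y in 𝓝 α, digit y ((T y)^[n] (f y)) = digit α ((T α)^[n] (f α)) := by
      have l1 : (digit α ((T α)^[n] (f α)) : ℝ) < 1 / |(T α)^[n] (f α)| + 1 - α := by
        refine lt_of_le_of_ne (Int.floor_le _) fun hh => hT ?_
        rw [T_of_ne hn, hh]; ring
      have l2 : 1 / |(T α)^[n] (f α)| + 1 - α < digit α ((T α)^[n] (f α)) + 1 :=
        Int.lt_floor_add_one _
      filter_upwards [hcv.eventually (lt_mem_nhds l1), hcv.eventually (gt_mem_nhds l2)] with y h2 h3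
      exact Int.floor_eq_iff.mpr ⟨h2.le, h3⟩
    have heps : ∀ᶠ y in 𝓝 α, eps ((T y)^[n] (f y)) = eps ((T α)^[n] (f α)) ∧
        (T y)^[n] (f y) ≠ 0 := by
      rcases lt_or_gt_of_ne hn with h | h
      · filter_upwards [hc.eventually (gt_mem_nhds h)] with y hy
        exact ⟨by rw [eps_of_neg h, eps_of_neg hy], hy.ne⟩
      · filter_upwards [hc.eventually (lt_mem_nhds h)] with y hy
        exact ⟨by rw [eps_of_pos h, eps_of_pos hy], hy.ne'⟩
    refine ⟨?_, ?_⟩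
    · have : ContinuousAt (fun y => 1 / |(T y)^[n] (f y)| - (digit α ((T α)^[n] (f α)) : ℝ)) α :=
        (continuousAt_const.div hc.abs (abs_ne_zero.mpr hn)).sub continuousAt_const
      refine this.congr ?_
      filter_upwards [hdig, heps] with y h2 h3
      rw [Function.iterate_succ_apply', T_of_ne h3.2, h2]
    · filter_upwards [hdig, heps, he] with y h2 h3 h4
      refine ⟨fun i hi => ?_, ?_⟩
      · rcases Nat.lt_succ_iff_lt_or_eq.mp hi with h | rfl
        · exact h4.1 i h
        · exact h3.2
      · rw [cfMatrix_succ, cfMatrix_succ, h4.2, stepMatrix, stepMatrix, h2, h3.1]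

theorem AlgMatching.eventually {α : ℝ} {n m : ℕ} (h0 : 0 < α) (h1 : α < 1)
    (hQ : α ∈ range ((↑) : ℚ → ℝ)) (h : AlgMatching n m α) :
    ∀ᶠ y in 𝓝 α, AlgMatching n m y := by
  obtain ⟨h2, h3, h4⟩ := h
  filter_upwards [(eventually_cfMatrix_eq (f := fun y => y) continuousAt_id n h2
      fun i _ => iterate_endpoint_ne h0 h1 hQ (Or.inl rfl) i).2,
    (eventually_cfMatrix_eq (f := fun y => y - 1) (continuousAt_id.sub continuousAt_const) m h3
      fun i _ => iterate_endpoint_ne h0 h1 hQ (Or.inr rfl) i).2] with y h5 h6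
  exact ⟨h5.1, h6.1, by rw [h5.2, h6.2, h4]⟩

/-- The matching interval around a point of the interior. -/
theorem exists_isMatchingInterval {α : ℝ} {n m : ℕ} (h : α ∈ matchingInterior n m) :
    ∃ J, IsMatchingInterval n m J ∧ α ∈ J :=
  ⟨_, ⟨α, h, rfl⟩, mem_connectedComponentIn h⟩

theorem IsMatchingInterval.mem_interior {α : ℝ} {n m : ℕ} {J : Set ℝ}
    (h : IsMatchingInterval n m J) (hJ : α ∈ J) : α ∈ matchingInterior n m := by
  obtain ⟨x, -, rfl⟩ := h
  exact connectedComponentIn_subset _ _ hJ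

theorem algMatching_of_mem_interior {α : ℝ} {n m : ℕ} (h : α ∈ matchingInterior n m) :
    AlgMatching n m α := h.2.self_of_nhdsWithin h.1

theorem inEven_iff {α : ℝ} : InEvenMatchingInterval α ↔
    ∃ n m : ℕ, α ∈ matchingInterior n m ∧ Even ((m : ℤ) - (n : ℤ)) := by
  constructor
  · rintro ⟨J, n, m, hJ, hα, he⟩
    exact ⟨n, m, hJ.mem_interior hα, he⟩
  · rintro ⟨n, m, hα, he⟩
    obtain ⟨J, hJ, hm⟩ := exists_isMatchingInterval hα
    exact ⟨J, n, m, hJ, hm, he⟩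

theorem InOddMatchingInterval.exists {α : ℝ} (h : InOddMatchingInterval α) :
    ∃ n m : ℕ, α ∈ matchingInterior n m ∧ Odd ((m : ℤ) - (n : ℤ)) := by
  obtain ⟨J, n, m, hJ, hα, he⟩ := h
  exact ⟨n, m, hJ.mem_interior hα, he⟩

/-- A rational `α ∈ (0, 1)` is in a matching interval, the parity of whose index is given by the
lengths of the orbits of `α` and `α - 1`. -/
theorem inEven_iff_firstZero {α : ℝ} {n₀ m₀ : ℕ} (h0 : 0 < α) (h1 : α < 1)
    (hn : FirstZero α α n₀) (hm : FirstZero α (α - 1) m₀) (hQ : α ∈ range ((↑) : ℚ → ℝ)) :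
    InEvenMatchingInterval α ↔ Even (n₀ + m₀) := by
  have key : ∀ n m : ℕ, AlgMatching n m α → (Even ((m : ℤ) - n) ↔ Even (n₀ + m₀)) := by
    intro n m h
    have := h.index_eq hn hm
    rw [Int.even_iff, Nat.even_iff]
    omega
  rw [inEven_iff]
  constructor
  · rintro ⟨n, m, h, he⟩
    exact (key n m (algMatching_of_mem_interior h)).mp he
  · intro he
    obtain ⟨n, m, h⟩ := exists_algMatching h0 h1 hQ
    exact ⟨n, m, ⟨⟨h0, h1.le⟩, (h.eventually h0 h1 hQ).filter_mono nhdsWithin_le_nhds⟩,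
      (key n m h).mpr he⟩

theorem InOddMatchingInterval.odd_firstZero {α : ℝ} {n₀ m₀ : ℕ} (h : InOddMatchingInterval α)
    (hn : FirstZero α α n₀) (hm : FirstZero α (α - 1) m₀) : Odd (n₀ + m₀) := by
  obtain ⟨n, m, hmem, ho⟩ := h.exists
  have := (algMatching_of_mem_interior hmem).index_eq hn hm
  rw [Int.odd_iff] at ho
  rw [Nat.odd_iff]
  omega

theorem not_inEven_one : ¬ InEvenMatchingInterval 1 := by
  rw [inEven_iff]
  rintro ⟨n, m, h, he⟩
  have h1 : FirstZero 1 1 1 := by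
    refine ⟨?_, fun i hi => ?_⟩
    · rw [Function.iterate_one, T_eq (c := 1) one_ne_zero] <;> norm_num
    · obtain rfl : i = 0 := by omega
      exact one_ne_zero
  have h2 : FirstZero 1 (1 - 1) 0 := ⟨sub_self 1, fun i hi => by omega⟩
  have := (algMatching_of_mem_interior h).index_eq h1 h2
  rw [Int.even_iff] at he
  omega

/-- The averages of `f` over `[0, h]` tend to `+∞` as `h → 0+`. -/
def AvgTop (f : ℝ → ℝ) : Prop :=
  Tendsto (fun h : ℝ => (1 / h) * ∫ u in (0 : ℝ)..h, f u) (𝓝[>] 0) atTop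

theorem AvgTop.not_neg {f : ℝ → ℝ} (h1 : AvgTop f) (h2 : AvgTop fun u => -f u) : False := by
  have h3 := (h1.eventually_gt_atTop 0).and (h2.eventually_gt_atTop 0)
  obtain ⟨h, h4, h5⟩ := h3.exists
  rw [intervalIntegral.integral_neg] at h5
  linarith

/-- The change of variables `x ↦ 1 / x` in local coordinates at `a` and at `1 / a`. -/
def invCoord (a ρ u : ℝ) : ℝ := u / (a * (a + ρ * u))

theorem add_mul_pos {a ρ u : ℝ} (ha : 0 < a) (hρ : ρ = 1 ∨ ρ = -1) (hu : 0 ≤ u)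
    (hua : u ≤ a / 2) : a / 2 ≤ a + ρ * u := by
  rcases hρ with rfl | rfl <;> linarith

theorem hasDerivAt_invCoord {a ρ u : ℝ} (ha : a ≠ 0) (hu : a + ρ * u ≠ 0) :
    HasDerivAt (invCoord a ρ) (1 / (a + ρ * u) ^ 2) u := by
  have h1 : HasDerivAt (fun u : ℝ => a * (a + ρ * u)) (a * (ρ * 1)) u :=
    (((hasDerivAt_id u).const_mul ρ).const_add a).const_mul a
  have h2 : HasDerivAt (invCoord a ρ)
      ((1 * (a * (a + ρ * u)) - u * (a * (ρ * 1))) / (a * (a + ρ * u)) ^ 2) u :=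
    (hasDerivAt_id u).div h1 (mul_ne_zero ha hu)
  convert h2 using 1
  field_simp
  ring

theorem invCoord_pos {a ρ u : ℝ} (ha : 0 < a) (hρ : ρ = 1 ∨ ρ = -1) (hu : 0 < u)
    (hua : u ≤ a / 2) : 0 < invCoord a ρ u := by
  have := add_mul_pos ha hρ hu.le hua
  exact div_pos hu (mul_pos ha (by linarith))

theorem invCoord_le_iff {a ρ u w : ℝ} (ha : 0 < a) (hρ : ρ = 1 ∨ ρ = -1) (hu : 0 < u)
    (hua : u ≤ a / 2) (hw : 0 < w) (hwa : w ≤ a / 2) :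
    invCoord a ρ u ≤ invCoord a ρ w ↔ u ≤ w := by
  have h1 := add_mul_pos ha hρ hu.le hua
  have h2 := add_mul_pos ha hρ hw.le hwa
  rw [invCoord, invCoord, div_le_div_iff₀ (mul_pos ha (by linarith)) (mul_pos ha (by linarith))]
  have e : w * (a * (a + ρ * u)) - u * (a * (a + ρ * w)) = (w - u) * (a * a) := by ring
  constructor
  · intro h
    by_contra hc
    have := mul_neg_of_neg_of_pos (by linarith : w - u < 0) (mul_pos ha ha)
    linarith
  · intro h
    have := mul_nonneg (sub_nonneg.mpr h) (mul_pos ha ha).le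
    linarith

theorem injOn_invCoord {a ρ h : ℝ} (ha : 0 < a) (hρ : ρ = 1 ∨ ρ = -1) (hh : h ≤ a / 2) :
    InjOn (invCoord a ρ) (Ioc 0 h) := by
  intro u hu w hw e
  exact le_antisymm
    ((invCoord_le_iff ha hρ hu.1 (hu.2.trans hh) hw.1 (hw.2.trans hh)).mp e.le)
    ((invCoord_le_iff ha hρ hw.1 (hw.2.trans hh) hu.1 (hu.2.trans hh)).mp e.ge)

theorem invCoord_zero (a ρ : ℝ) : invCoord a ρ 0 = 0 := by simp [invCoord]

theorem image_invCoord {a ρ h : ℝ} (ha : 0 < a) (hρ : ρ = 1 ∨ ρ = -1) (h0 : 0 < h)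
    (hh : h ≤ a / 2) : invCoord a ρ '' Ioc 0 h = Ioc 0 (invCoord a ρ h) := by
  apply Subset.antisymm
  · rintro _ ⟨u, hu, rfl⟩
    exact ⟨invCoord_pos ha hρ hu.1 (hu.2.trans hh),
      (invCoord_le_iff ha hρ hu.1 (hu.2.trans hh) h0 hh).mpr hu.2⟩
  · intro w hw
    have hcont : ContinuousOn (invCoord a ρ) (Icc 0 h) := by
      intro u hu
      have := add_mul_pos ha hρ hu.1 (hu.2.trans hh)
      exact (hasDerivAt_invCoord ha.ne' (by linarith)).continuousAt.continuousWithinAt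
    have := intermediate_value_Icc h0.le hcont
    rw [invCoord_zero] at this
    obtain ⟨u, hu, rfl⟩ := this (Ioc_subset_Icc_self hw)
    refine ⟨u, ⟨lt_of_le_of_ne hu.1 ?_, hu.2⟩, rfl⟩
    rintro rfl
    rw [invCoord_zero] at hw
    exact lt_irrefl _ hw.1

theorem tendsto_invCoord {a ρ : ℝ} (ha : 0 < a) (hρ : ρ = 1 ∨ ρ = -1) :
    Tendsto (invCoord a ρ) (𝓝[>] 0) (𝓝[>] 0) := by
  refine tendsto_nhdsWithin_iff.mpr ⟨?_, ?_⟩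
  · have h : ContinuousAt (invCoord a ρ) 0 :=
      (hasDerivAt_invCoord ha.ne' (by simpa using ha.ne')).continuousAt
    have := h.tendsto
    rw [invCoord_zero] at this
    exact this.mono_left nhdsWithin_le_nhds
  · filter_upwards [Ioo_mem_nhdsGT (half_pos ha)] with u hu
    exact invCoord_pos ha hρ hu.1 hu.2.le

theorem exists_integrableOn_Ioc {f : ℝ → ℝ} (hf : IntegrableAtFilter f (𝓝[>] 0) volume) :
    ∃ δ > 0, IntegrableOn f (Ioc 0 δ) := by
  obtain ⟨s, hs, hfs⟩ := hf
  obtain ⟨δ, hδ, hsub⟩ := mem_nhdsGT_iff_exists_Ioc_subset.mp hs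
  exact ⟨δ, hδ, hfs.mono_set hsub⟩

theorem invCoord_invCoord {a ρ u : ℝ} (ha : 0 < a) (hρ : ρ = 1 ∨ ρ = -1) (hu : 0 < u)
    (hua : u ≤ a⁻¹ / 2) : invCoord a ρ (invCoord a⁻¹ (-ρ) u) = u ∧
      a + ρ * invCoord a⁻¹ (-ρ) u = (a⁻¹ + -ρ * u)⁻¹ := by
  have hai : 0 < a⁻¹ := inv_pos.mpr ha
  have h1 := add_mul_pos hai (ρ := -ρ) (by rcases hρ with rfl | rfl <;> simp) hu.le hua
  have h2 : a⁻¹ + -ρ * u ≠ 0 := by linarith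
  have h3 : 1 - u * a * ρ ≠ 0 := by
    have : 1 - u * a * ρ = a * (a⁻¹ + -ρ * u) := by field_simp; ring
    rw [this]; exact mul_ne_zero ha.ne' h2
  have e : a⁻¹ + -ρ * u = (1 - u * a * ρ) / a := by field_simp; ring
  have e2 : a + ρ * invCoord a⁻¹ (-ρ) u = (a⁻¹ + -ρ * u)⁻¹ := by
    rw [invCoord]
    have hX : ρ * u = a⁻¹ - (a⁻¹ + -ρ * u) := by ring
    generalize a⁻¹ + -ρ * u = X at *
    have : ρ * (u / (a⁻¹ * X)) = (ρ * u) * a / X := by field_simp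
    rw [this, hX]
    field_simp
    ring
  refine ⟨?_, e2⟩
  rw [invCoord, e2, invCoord, e]
  field_simp

/-- If `f` and `g` are related by `f(x) = -x g(1/x)` up to a bounded error, in local coordinates
at `a` and `1 / a`, and if the averages of `g` tend to `+∞`, then those of `f` tend to `-∞`. -/
theorem AvgTop.transfer {f g : ℝ → ℝ} {a ρ C : ℝ} (ha : 0 < a) (hρ : ρ = 1 ∨ ρ = -1)
    (hf : IntegrableAtFilter f (𝓝[>] 0) volume) (hg : IntegrableAtFilter g (𝓝[>] 0) volume)
    (hC : ∀ᶠ u in 𝓝[>] 0, |f u + (a + ρ * u) * g (invCoord a ρ u)| ≤ C)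
    (h : AvgTop g) : AvgTop fun u => -f u := by
  obtain ⟨δ, hδ, hfi⟩ := exists_integrableOn_Ioc hf
  obtain ⟨δ', hδ', hgi⟩ := exists_integrableOn_Ioc hg
  obtain ⟨δ'', hδ'', hCs⟩ := mem_nhdsGT_iff_exists_Ioc_subset.mp hC
  set K := ∫ u in Ioc 0 δ', |g u|
  have hlim : Tendsto (fun h : ℝ => a ^ 3 * (1 / (a * (a + ρ * h)) *
      ((1 / invCoord a ρ h) * ∫ u in (0 : ℝ)..invCoord a ρ h, g u)) + -(7 * a ^ 2 * K + C))
      (𝓝[>] 0) atTop := by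
    refine tendsto_atTop_add_const_right _ _ (Tendsto.const_mul_atTop (by positivity) ?_)
    have h1 : Tendsto (fun h : ℝ => 1 / (a * (a + ρ * h))) (𝓝[>] 0) (𝓝 (1 / (a * (a + ρ * 0)))) := by
      have : ContinuousAt (fun h : ℝ => 1 / (a * (a + ρ * h))) 0 := by
        refine ContinuousAt.div continuousAt_const (by fun_prop) ?_
        simpa using ha.ne'
      exact this.tendsto.mono_left nhdsWithin_le_nhds
    refine Tendsto.pos_mul_atTop (C := 1 / (a * (a + ρ * 0))) (by rw [mul_zero, add_zero]; positivity) h1 ?_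
    exact Tendsto.comp h (tendsto_invCoord ha hρ)
  refine tendsto_atTop_mono' _ ?_ hlim
  have hsmall : ∀ᶠ h in 𝓝[>] (0 : ℝ), invCoord a ρ h ∈ Ioo 0 δ' :=
    (tendsto_invCoord ha hρ).eventually (Ioo_mem_nhdsGT hδ')
  filter_upwards [hsmall, Ioo_mem_nhdsGT hδ, Ioo_mem_nhdsGT hδ'', Ioo_mem_nhdsGT (half_pos ha)]
    with h h1 h2 h3 h4
  have h0 : 0 < h := h2.1
  have hder : ∀ u ∈ Ioc 0 h,
      HasDerivWithinAt (invCoord a ρ) (1 / (a + ρ * u) ^ 2) (Ioc 0 h) u := by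
    intro u hu
    have := add_mul_pos ha hρ hu.1.le (hu.2.trans h4.2.le)
    exact (hasDerivAt_invCoord ha.ne' (by linarith)).hasDerivWithinAt
  have hinj := injOn_invCoord ha hρ h4.2.le
  have himg := image_invCoord ha hρ h0 h4.2.le
  set G : ℝ → ℝ := fun u => |1 / (a + ρ * u) ^ 2| • g (invCoord a ρ u) with hG
  have hGi : IntegrableOn G (Ioc 0 h) := by
    rw [← integrableOn_image_iff_integrableOn_abs_deriv_smul measurableSet_Ioc hder hinj, himg]
    exact hgi.mono_set (Ioc_subset_Ioc_right h1.2.le)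
  have hGint : ∫ u in Ioc 0 (invCoord a ρ h), g u = ∫ u in Ioc 0 h, G u := by
    rw [← himg, integral_image_eq_integral_abs_deriv_smul measurableSet_Ioc hder hinj]
  have hGabs : ∫ u in Ioc 0 h, |G u| ≤ K := by
    have : ∫ u in Ioc 0 (invCoord a ρ h), |g u| = ∫ u in Ioc 0 h, |G u| := by
      rw [← himg, integral_image_eq_integral_abs_deriv_smul measurableSet_Ioc hder hinj]
      refine setIntegral_congr_fun measurableSet_Ioc fun u _ => ?_
      simp only [hG, smul_eq_mul, abs_mul, abs_abs]
    rw [← this]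
    exact setIntegral_mono_set hgi.abs (Eventually.of_forall fun u => abs_nonneg _)
      (Ioc_subset_Ioc_right h1.2.le).eventuallyLE
  have i1 : IntegrableOn (fun u => a ^ 3 * G u) (Ioc 0 h) := hGi.const_mul _
  have i2 : IntegrableOn (fun u => 7 * a ^ 2 * h * |G u|) (Ioc 0 h) := hGi.abs.const_mul _
  have i3 : IntegrableOn (fun u => a ^ 3 * G u - 7 * a ^ 2 * h * |G u|) (Ioc 0 h) := i1.sub i2
  have i4 : IntegrableOn (fun _ : ℝ => C) (Ioc 0 h) := integrableOn_const (by simp)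
  have hmono : ∫ u in Ioc 0 h, (a ^ 3 * G u - 7 * a ^ 2 * h * |G u| - C) ≤
      ∫ u in Ioc 0 h, -f u := by
    refine setIntegral_mono_on (i3.sub i4) (hfi.mono_set (Ioc_subset_Ioc_right h2.2.le)).neg
      measurableSet_Ioc fun u hu => ?_
    have hb0 : |f u + (a + ρ * u) * g (invCoord a ρ u)| ≤ C := hCs ⟨hu.1, hu.2.trans h3.2.le⟩
    have hb := (abs_le.mp hb0).2
    have hp := add_mul_pos ha hρ hu.1.le (hu.2.trans h4.2.le)
    have hgG : (a + ρ * u) * g (invCoord a ρ u) = (a + ρ * u) ^ 3 * G u := by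
      have : a + ρ * u ≠ 0 := by linarith
      rw [hG]
      simp only [smul_eq_mul]
      rw [abs_of_pos (by positivity)]
      field_simp
    rw [hgG] at hb
    have hcub : |(a + ρ * u) ^ 3 - a ^ 3| ≤ 7 * a ^ 2 * h := by
      have e : (a + ρ * u) ^ 3 - a ^ 3 = ρ * u * (3 * a ^ 2 + 3 * a * (ρ * u) + (ρ * u) ^ 2) := by
        ring
      have hρu : |ρ * u| = u := by
        rcases hρ with rfl | rfl <;> simp [abs_of_pos hu.1]
      have hua : u ≤ a := by linarith [hu.2, h4.2]
      rw [e, abs_mul, hρu]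
      have h5 : |3 * a ^ 2 + 3 * a * (ρ * u) + (ρ * u) ^ 2| ≤ 7 * a ^ 2 := by
        refine (abs_add_three _ _ _).trans ?_
        rw [abs_mul (3 * a), hρu, abs_pow, hρu, abs_of_pos (by positivity : 0 < 3 * a ^ 2),
          abs_of_pos (by positivity : 0 < 3 * a)]
        have := hu.1
        nlinarith
      calc u * |3 * a ^ 2 + 3 * a * (ρ * u) + (ρ * u) ^ 2| ≤ h * (7 * a ^ 2) :=
            mul_le_mul hu.2 h5 (abs_nonneg _) h0.le
        _ = 7 * a ^ 2 * h := by ring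
    have hcubG : -(7 * a ^ 2 * h * |G u|) ≤ ((a + ρ * u) ^ 3 - a ^ 3) * G u := by
      have := mul_le_mul_of_nonneg_right hcub (abs_nonneg (G u))
      rw [← abs_mul] at this
      linarith [neg_abs_le (((a + ρ * u) ^ 3 - a ^ 3) * G u)]
    linarith
  rw [integral_sub i3 i4, integral_sub i1 i2, integral_const_mul, integral_const_mul,
    setIntegral_const, Real.volume_real_Ioc_of_le h0.le, smul_eq_mul, ← hGint] at hmono
  rw [intervalIntegral.integral_of_le h1.1.le, intervalIntegral.integral_of_le h0.le]
  have hK : 7 * a ^ 2 * h * ∫ u in Ioc 0 h, |G u| ≤ 7 * a ^ 2 * h * K :=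
    mul_le_mul_of_nonneg_left hGabs (by positivity)
  have hfac : 1 / (a * (a + ρ * h)) * (1 / invCoord a ρ h) = 1 / h := by
    have := add_mul_pos ha hρ h0.le h4.2.le
    have : a + ρ * h ≠ 0 := by linarith
    rw [invCoord]; field_simp
  rw [← mul_assoc (1 / (a * (a + ρ * h))), hfac, one_div, inv_mul_eq_div, inv_mul_eq_div,
    le_div_iff₀ h0]
  have : (a ^ 3 * ((∫ u in Ioc 0 (invCoord a ρ h), g u) / h) + -(7 * a ^ 2 * K + C)) * h =
      a ^ 3 * (∫ u in Ioc 0 (invCoord a ρ h), g u) - 7 * a ^ 2 * h * K - h * C := by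
    field_simp
    ring
  rw [this]
  linarith

/-- The relation in `AvgTop.transfer` is symmetric. -/
theorem eventually_transfer_symm {f g : ℝ → ℝ} {a ρ C : ℝ} (ha : 0 < a) (hρ : ρ = 1 ∨ ρ = -1)
    (hC : ∀ᶠ u in 𝓝[>] 0, |f u + (a + ρ * u) * g (invCoord a ρ u)| ≤ C) :
    ∀ᶠ u in 𝓝[>] 0, |g u + (a⁻¹ + -ρ * u) * f (invCoord a⁻¹ (-ρ) u)| ≤ 2 * a⁻¹ * C := by
  have hai : 0 < a⁻¹ := inv_pos.mpr ha
  have hρ' : -ρ = 1 ∨ -ρ = -1 := by rcases hρ with rfl | rfl <;> simp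
  filter_upwards [(tendsto_invCoord hai hρ').eventually hC, Ioo_mem_nhdsGT (half_pos hai)]
    with u hu hu2
  obtain ⟨e1, e2⟩ := invCoord_invCoord ha hρ hu2.1 hu2.2.le
  have hp := add_mul_pos hai hρ' hu2.1.le hu2.2.le
  have hp' : 0 < a⁻¹ + -ρ * u := by linarith
  rw [e1, e2] at hu
  have e : g u + (a⁻¹ + -ρ * u) * f (invCoord a⁻¹ (-ρ) u) = (a⁻¹ + -ρ * u) *
      (f (invCoord a⁻¹ (-ρ) u) + (a⁻¹ + -ρ * u)⁻¹ * g u) := by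
    rw [mul_add, mul_inv_cancel_left₀ hp'.ne', add_comm]
  rw [e, abs_mul, abs_of_pos hp']
  have hle : a⁻¹ + -ρ * u ≤ 2 * a⁻¹ := by
    rcases hρ with rfl | rfl <;> linarith [hu2.1, hu2.2]
  exact mul_le_mul hle hu (abs_nonneg _) (by linarith)

/-- Integrability is passed on by the relation in `AvgTop.transfer`. -/
theorem integrableAt_transfer {f g : ℝ → ℝ} {a ρ C : ℝ} (ha : 0 < a) (hρ : ρ = 1 ∨ ρ = -1)
    (hf : IntegrableAtFilter f (𝓝[>] 0) volume) (hg : Measurable g)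
    (hC : ∀ᶠ u in 𝓝[>] 0, |f u + (a + ρ * u) * g (invCoord a ρ u)| ≤ C) :
    IntegrableAtFilter g (𝓝[>] 0) volume := by
  obtain ⟨δ, hδ, hfi⟩ := exists_integrableOn_Ioc hf
  obtain ⟨δ', hδ', hCs⟩ := mem_nhdsGT_iff_exists_Ioc_subset.mp hC
  obtain ⟨h, h0, hh⟩ : ∃ h : ℝ, 0 < h ∧ h ≤ δ ∧ h ≤ δ' ∧ h ≤ a / 2 :=
    ⟨min δ (min δ' (a / 2)), lt_min hδ (lt_min hδ' (half_pos ha)), min_le_left _ _,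
      (min_le_right _ _).trans (min_le_left _ _), (min_le_right _ _).trans (min_le_right _ _)⟩
  refine ⟨Ioc 0 (invCoord a ρ h), Ioc_mem_nhdsGT (invCoord_pos ha hρ h0 hh.2.2), ?_⟩
  have hder : ∀ u ∈ Ioc 0 h,
      HasDerivWithinAt (invCoord a ρ) (1 / (a + ρ * u) ^ 2) (Ioc 0 h) u := by
    intro u hu
    have := add_mul_pos ha hρ hu.1.le (hu.2.trans hh.2.2)
    exact (hasDerivAt_invCoord ha.ne' (by linarith)).hasDerivWithinAt
  rw [← image_invCoord ha hρ h0 hh.2.2, integrableOn_image_iff_integrableOn_abs_deriv_smul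
    measurableSet_Ioc hder (injOn_invCoord ha hρ hh.2.2)]
  have hdom : IntegrableOn (fun u => ((a / 2) ^ 3)⁻¹ * (C + |f u|)) (Ioc 0 h) :=
    ((integrableOn_const (by simp)).add (hfi.mono_set (Ioc_subset_Ioc_right hh.1)).abs).const_mul _
  refine Integrable.mono' hdom ?_ ?_
  · have hm : Measurable (invCoord a ρ) := by unfold invCoord; fun_prop
    exact (Measurable.aestronglyMeasurable (by fun_prop))
  · refine (ae_restrict_iff' measurableSet_Ioc).mpr (Eventually.of_forall fun u hu => ?_)
    have hp := add_mul_pos ha hρ hu.1.le (hu.2.trans hh.2.2)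
    have hp0 : 0 < a + ρ * u := by linarith
    have hb : |f u + (a + ρ * u) * g (invCoord a ρ u)| ≤ C := hCs ⟨hu.1, hu.2.trans hh.2.1⟩
    have h1 : (a + ρ * u) * |g (invCoord a ρ u)| ≤ C + |f u| := by
      have := abs_sub (f u + (a + ρ * u) * g (invCoord a ρ u)) (f u)
      rw [add_sub_cancel_left, abs_mul, abs_of_pos hp0] at this
      linarith
    rw [norm_smul, Real.norm_eq_abs, Real.norm_eq_abs, abs_abs, abs_of_pos (by positivity)]
    calc 1 / (a + ρ * u) ^ 2 * |g (invCoord a ρ u)|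
        = ((a + ρ * u) ^ 3)⁻¹ * ((a + ρ * u) * |g (invCoord a ρ u)|) := by field_simp
      _ ≤ ((a / 2) ^ 3)⁻¹ * (C + |f u|) := by
          refine mul_le_mul ?_ h1 (by positivity) (by positivity)
          gcongr

theorem T_eq_ite (α : ℝ) :
    T α = fun x => if x = 0 then 0 else 1 / |x| - ((⌊1 / |x| + 1 - α⌋ : ℤ) : ℝ) := by
  funext x
  by_cases hx : x = 0
  · simp [hx, T_zero]
  · rw [T_of_ne hx, if_neg hx, digit]

theorem measurable_T (α : ℝ) : Measurable (T α) := by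
  rw [T_eq_ite]
  have h1 : Measurable fun x : ℝ => 1 / |x| := by fun_prop
  have h2 : Measurable fun x : ℝ => ((⌊1 / |x| + 1 - α⌋ : ℤ) : ℝ) :=
    (measurable_from_top (f := fun n : ℤ => (n : ℝ))).comp
      (Int.measurable_floor.comp ((h1.add_const 1).sub_const α))
  exact Measurable.ite (measurableSet_singleton 0) measurable_const (h1.sub h2)

theorem measurable_iterate_T (α : ℝ) (j : ℕ) : Measurable ((T α)^[j]) :=
  (measurable_T α).iterate j

theorem measurable_abs_iterate_T (α : ℝ) (j : ℕ) : Measurable fun x => |(T α)^[j] x| :=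
  (measurable_iterate_T α j).norm

theorem measurable_betaProd (α : ℝ) (j : ℕ) : Measurable fun x => betaProd α x j := by
  unfold betaProd
  exact Finset.measurable_prod _ fun i _ => measurable_abs_iterate_T α i

/-- The terms of the Wilton series. -/
def wiltonTerm (α x : ℝ) (j : ℕ) : ℝ :=
  (-1 : ℝ) ^ j * betaProd α x j * Real.log (1 / |(T α)^[j] x|)

theorem measurable_wiltonTerm (α : ℝ) (j : ℕ) : Measurable fun x => wiltonTerm α x j := by
  unfold wiltonTerm
  have h1 := measurable_betaProd α j
  have h2 := measurable_abs_iterate_T α j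
  fun_prop

theorem wiltonSeries_eq (α x : ℝ) :
    wiltonSeries α x = ∑'[SummationFilter.conditional ℕ] j : ℕ, wiltonTerm α x j := rfl

theorem measurable_wiltonSeries (α : ℝ) : Measurable (wiltonSeries α) :=
  Measurable.tsum fun j => measurable_wiltonTerm α j

theorem measurable_wilton (α : ℝ) : Measurable (wilton α) := by
  have h2 : Measurable fun x : ℝ => ((⌊x + 1 - α⌋ : ℤ) : ℝ) :=
    (measurable_from_top (f := fun n : ℤ => (n : ℝ))).comp
      (Int.measurable_floor.comp ((measurable_id.add_const 1).sub_const α))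
  exact (measurable_wiltonSeries α).comp (measurable_id.sub h2)

theorem wilton_of_mem {α x : ℝ} (hx : x ∈ Ico (α - 1) α) : wilton α x = wiltonSeries α x := by
  have : ⌊x + 1 - α⌋ = 0 := by
    rw [Int.floor_eq_iff]
    constructor <;> push_cast <;> linarith [hx.1, hx.2]
  rw [wilton, this, Int.cast_zero, sub_zero]

theorem wilton_add_int (α x : ℝ) (n : ℤ) : wilton α (x + n) = wilton α x := by
  have : x + n + 1 - α = x + 1 - α + n := by ring
  rw [wilton, this, Int.floor_add_intCast, wilton]
  push_cast
  ring_nf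

theorem wilton_periodic (α : ℝ) : Function.Periodic (wilton α) 1 := fun x => by
  simpa using wilton_add_int α x 1

theorem wiltonTerm_zero (α x : ℝ) : wiltonTerm α x 0 = -Real.log |x| := by
  simp [wiltonTerm, betaProd]

theorem betaProd_succ (α x : ℝ) (j : ℕ) : betaProd α x (j + 1) = |x| * betaProd α (T α x) j := by
  rw [betaProd, Finset.prod_range_succ', mul_comm]
  rfl

theorem wiltonTerm_succ (α x : ℝ) (j : ℕ) :
    wiltonTerm α x (j + 1) = -|x| * wiltonTerm α (T α x) j := by
  rw [wiltonTerm, wiltonTerm, betaProd_succ, Function.iterate_succ_apply, pow_succ]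
  ring

theorem hasSum_conditional_iff {f : ℕ → ℝ} {a : ℝ} :
    HasSum f a (SummationFilter.conditional ℕ) ↔
      Tendsto (fun n => ∑ i ∈ Finset.range n, f i) atTop (𝓝 a) := by
  rw [HasSum, SummationFilter.conditional_filter_eq_map_range, tendsto_map'_iff]
  rfl

theorem sum_wiltonTerm_succ (α x : ℝ) (n : ℕ) :
    ∑ i ∈ Finset.range (n + 1), wiltonTerm α x i =
      -|x| * ∑ i ∈ Finset.range n, wiltonTerm α (T α x) i + -Real.log |x| := by
  rw [Finset.sum_range_succ', wiltonTerm_zero, Finset.mul_sum]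
  simp_rw [wiltonTerm_succ]

theorem hasSum_wiltonTerm {α x a : ℝ}
    (h : HasSum (wiltonTerm α (T α x)) a (SummationFilter.conditional ℕ)) :
    HasSum (wiltonTerm α x) (-|x| * a + -Real.log |x|) (SummationFilter.conditional ℕ) := by
  rw [hasSum_conditional_iff] at *
  rw [← tendsto_add_atTop_iff_nat 1]
  simp_rw [sum_wiltonTerm_succ]
  exact (h.const_mul _).add_const _

theorem summable_wiltonTerm_map {α x : ℝ} (hx : x ≠ 0)
    (h : Summable (wiltonTerm α x) (SummationFilter.conditional ℕ)) :
    Summable (wiltonTerm α (T α x)) (SummationFilter.conditional ℕ) := by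
  obtain ⟨a, ha⟩ := h
  refine ⟨(-|x|)⁻¹ * (a - -Real.log |x|), ?_⟩
  rw [hasSum_conditional_iff] at *
  have h1 := (((tendsto_add_atTop_iff_nat 1).mpr ha).sub_const (-Real.log |x|)).const_mul (-|x|)⁻¹
  simp_rw [sum_wiltonTerm_succ, add_sub_cancel_right] at h1
  have hx' : -|x| ≠ 0 := neg_ne_zero.mpr (abs_ne_zero.mpr hx)
  simpa only [inv_mul_cancel_left₀ hx'] using h1

theorem wilton_one_div_abs {α x : ℝ} (hx : x ≠ 0) :
    wilton α (1 / |x|) = wiltonSeries α (T α x) := by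
  rw [← wilton_of_mem (T_mem hx), T_of_ne hx]
  simpa [sub_eq_add_neg] using (wilton_add_int α (1 / |x|) (-digit α x)).symm

/-- The functional equation of the Wilton function, where the series converges. -/
theorem wilton_eq_of_summable {α x : ℝ} (hx : x ∈ Ico (α - 1) α) (h0 : x ≠ 0)
    (h : Summable (wiltonTerm α x) (SummationFilter.conditional ℕ)) :
    wilton α x = -Real.log |x| - |x| * wilton α (1 / |x|) := by
  rw [wilton_of_mem hx, wilton_one_div_abs h0, wiltonSeries_eq, wiltonSeries_eq,
    (hasSum_wiltonTerm (summable_wiltonTerm_map h0 h).hasSum).tsum_eq]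
  ring

/-- The functional equation of the Wilton function, up to a bounded error, regardless of the
convergence of the series. -/
theorem abs_wilton_add_le {α x : ℝ} (hx : x ∈ Ico (α - 1) α) (h0 : x ≠ 0) :
    |wilton α x + |x| * wilton α (1 / |x|)| ≤ |Real.log (|x|)| := by
  by_cases h : Summable (wiltonTerm α x) (SummationFilter.conditional ℕ)
  · rw [wilton_eq_of_summable hx h0 h, sub_add_cancel, abs_neg]
  · have h' : ¬ Summable (wiltonTerm α (T α x)) (SummationFilter.conditional ℕ) :=
      fun hs => h ⟨_, hasSum_wiltonTerm hs.hasSum⟩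
    rw [wilton_of_mem hx, wilton_one_div_abs h0, wiltonSeries_eq, wiltonSeries_eq,
      tsum_eq_zero_of_not_summable h, tsum_eq_zero_of_not_summable h']
    simp

/-- The averages of `s * wilton α` on the side `σ` of `ξ` tend to `+∞`. -/
def SideTop (α ξ σ s : ℝ) : Prop := AvgTop fun u => s * wilton α (ξ + σ * u)

theorem SideTop.not_neg {α ξ σ s : ℝ} (h1 : SideTop α ξ σ s) (h2 : SideTop α ξ σ (-s)) : False := by
  refine AvgTop.not_neg h1 ?_
  have : (fun u => -(s * wilton α (ξ + σ * u))) = fun u => -s * wilton α (ξ + σ * u) := by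
    funext u; ring
  rw [this]; exact h2

theorem sideTop_add_int {α ξ σ s : ℝ} (n : ℤ) : SideTop α (ξ + n) σ s ↔ SideTop α ξ σ s := by
  have : (fun u => s * wilton α (ξ + n + σ * u)) = fun u => s * wilton α (ξ + σ * u) := by
    funext u
    rw [← wilton_add_int α (ξ + σ * u) n]
    ring_nf
  rw [SideTop, this, SideTop]

/-- The Wilton function on the side `σ` of `ξ` lies in `[α - 1, α)`. -/
def SideIn (α ξ σ : ℝ) : Prop := ∀ᶠ u in 𝓝[>] (0 : ℝ), ξ + σ * u ∈ Ico (α - 1) α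

theorem sideIn_of_mem_Ioo {α ξ σ : ℝ} (h : ξ ∈ Ioo (α - 1) α) : SideIn α ξ σ := by
  have hc : ContinuousAt (fun u : ℝ => ξ + σ * u) 0 := by fun_prop
  have : Ico (α - 1) α ∈ 𝓝 (ξ + σ * 0) := by
    simpa using Ico_mem_nhds h.1 h.2
  exact (hc.eventually this).filter_mono nhdsWithin_le_nhds

theorem sideIn_left_endpoint (α : ℝ) : SideIn α (α - 1) 1 := by
  filter_upwards [Ioo_mem_nhdsGT one_pos] with u hu
  constructor <;> linarith [hu.1, hu.2]

theorem sideIn_right_endpoint (α : ℝ) : SideIn α α (-1) := by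
  filter_upwards [Ioo_mem_nhdsGT one_pos] with u hu
  constructor <;> linarith [hu.1, hu.2]

theorem sideIn_right {α ξ : ℝ} (h : ξ ∈ Ico (α - 1) α) : SideIn α ξ 1 := by
  rcases eq_or_lt_of_le h.1 with rfl | h'
  · exact sideIn_left_endpoint α
  · exact sideIn_of_mem_Ioo ⟨h', h.2⟩

/-- The functional equation in the form that is needed for `AvgTop.transfer`. -/
theorem eventually_wilton_relation {α ξ σ s : ℝ} (hσ : σ = 1 ∨ σ = -1) (hs : s = 1 ∨ s = -1)
    (hξ : ξ ≠ 0) (hin : SideIn α ξ σ) :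
    ∃ ρ C : ℝ, (ρ = 1 ∨ ρ = -1) ∧ ρ = σ * eps ξ ∧ ∀ᶠ u in 𝓝[>] (0 : ℝ),
      |s * wilton α (ξ + σ * u) + (|ξ| + ρ * u) *
        (s * wilton α (T α ξ + -ρ * invCoord (|ξ|) ρ u))| ≤ C := by
  have ha : 0 < |ξ| := abs_pos.mpr hξ
  have heps : (eps ξ : ℝ) = 1 ∨ (eps ξ : ℝ) = -1 := by
    rcases lt_or_gt_of_ne hξ with h | h
    · right; simp [eps_of_neg h]
    · left; simp [eps_of_pos h]
  have hρ : σ * eps ξ = 1 ∨ σ * eps ξ = -1 := by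
    rcases heps with h | h <;> rcases hσ with rfl | rfl <;> simp [h]
  have hξe : ξ = eps ξ * |ξ| := by
    rcases lt_or_gt_of_ne hξ with h | h
    · simp [eps_of_neg h, abs_of_neg h]
    · simp [eps_of_pos h, abs_of_pos h]
  have hc : ContinuousAt (fun u : ℝ => |Real.log (|ξ + σ * u|)|) 0 := by
    refine (ContinuousAt.log (by fun_prop) ?_).abs
    simpa using hξ
  have hb : ∀ᶠ u in 𝓝[>] (0 : ℝ), |Real.log (|ξ + σ * u|)| < |Real.log (|ξ + σ * 0|)| + 1 :=
    (hc.eventually (gt_mem_nhds (lt_add_one _))).filter_mono nhdsWithin_le_nhds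
  refine ⟨σ * eps ξ, |Real.log (|ξ + σ * 0|)| + 1, hρ, rfl, ?_⟩
  filter_upwards [hin, hb, Ioo_mem_nhdsGT (half_pos ha)] with u h1 h2 h3
  have hp := add_mul_pos ha hρ h3.1.le h3.2.le
  have hpos : 0 < |ξ| + σ * eps ξ * u := by linarith
  have hee : (eps ξ : ℝ) * eps ξ = 1 := by rcases heps with h | h <;> rw [h] <;> norm_num
  have habs : |ξ + σ * u| = |ξ| + σ * eps ξ * u := by
    have e : ξ + σ * u = eps ξ * (|ξ| + σ * eps ξ * u) := by
      linear_combination hξe - σ * u * hee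
    have h1 : |(eps ξ : ℝ)| = 1 := by rcases heps with h | h <;> rw [h] <;> norm_num
    rw [e, abs_mul, h1, abs_of_pos hpos, one_mul]
  have hne : ξ + σ * u ≠ 0 := by
    rw [← abs_pos, habs]; exact hpos
  have hinv : 1 / (|ξ| + σ * eps ξ * u) =
      T α ξ + -(σ * eps ξ) * invCoord |ξ| (σ * eps ξ) u + digit α ξ := by
    rw [T_of_ne hξ, invCoord]
    field_simp
    ring
  have key := abs_wilton_add_le h1 hne
  rw [habs, hinv, wilton_add_int, ← habs] at key
  have hs' : |s| = 1 := by rcases hs with rfl | rfl <;> norm_num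
  calc _ = |s * (wilton α (ξ + σ * u) + |ξ + σ * u| *
        wilton α (T α ξ + -(σ * eps ξ) * invCoord |ξ| (σ * eps ξ) u))| := by
        rw [habs]; congr 1; ring
    _ ≤ _ := by rw [abs_mul, hs', one_mul]; exact key.trans h2.le

/-- The part of the branch of `T α` with digit `k + 1` on the side `s` of `0`. -/
def branch (α s : ℝ) (k : ℕ) : Set ℝ := {x | x ∈ Ico (α - 1) α ∧ 0 < s * x ∧ digit α x = k + 1}

theorem measurableSet_branch (α s : ℝ) (k : ℕ) : MeasurableSet (branch α s k) := by
  have h1 : Measurable fun x : ℝ => 1 / |x| := by fun_prop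
  have h2 : Measurable fun x : ℝ => digit α x :=
    Int.measurable_floor.comp ((h1.add_const 1).sub_const α)
  refine measurableSet_Ico.inter (MeasurableSet.inter ?_ (h2 (measurableSet_singleton _)))
  exact measurableSet_lt measurable_const (measurable_id.const_mul s)

theorem abs_le_of_mem_branch {α s x : ℝ} {k : ℕ} (h0 : 0 < α) (h1 : α ≤ 1)
    (hx : x ∈ branch α s k) : 0 < |x| ∧ |x| ≤ 2 / (k + 1) := by
  obtain ⟨hI, hs, hd⟩ := hx
  have hx0 : x ≠ 0 := by rintro rfl; simp at hs
  have hpos : 0 < |x| := abs_pos.mpr hx0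
  refine ⟨hpos, ?_⟩
  have h2 : 1 < 1 / |x| := by rw [lt_div_iff₀ hpos, one_mul]; exact abs_lt_one h0 h1 hI
  have h3 := Int.floor_le (1 / |x| + 1 - α)
  rw [digit] at hd
  rw [hd] at h3
  push_cast at h3
  have h4 : (k + 1 : ℝ) / 2 ≤ 1 / |x| := by linarith
  rw [le_div_iff₀ hpos] at h4
  rw [le_div_iff₀ (by positivity)]
  linarith

theorem exists_mem_branch {α x : ℝ} (h0 : 0 < α) (h1 : α ≤ 1) (hI : x ∈ Ico (α - 1) α)
    (hx : x ≠ 0) : ∃ k, x ∈ branch α 1 k ∪ branch α (-1) k := by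
  have hpos : 0 < |x| := abs_pos.mpr hx
  have h2 : 1 < 1 / |x| := by rw [lt_div_iff₀ hpos, one_mul]; exact abs_lt_one h0 h1 hI
  have h3 : 1 ≤ digit α x := by
    rw [digit, Int.le_floor]
    push_cast
    linarith
  refine ⟨(digit α x - 1).toNat, ?_⟩
  have hd : digit α x = ((digit α x - 1).toNat : ℤ) + 1 := by omega
  rcases lt_or_gt_of_ne hx with h | h
  · exact Or.inr ⟨hI, by linarith, hd⟩
  · exact Or.inl ⟨hI, by linarith, hd⟩

theorem lintegral_branch_le {α s : ℝ} (h0 : 0 < α) (h1 : α ≤ 1) (hs : s = 1 ∨ s = -1) (k : ℕ)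
    (f : ℝ → ENNReal) : ∫⁻ x in branch α s k, f (T α x) ≤
      ENNReal.ofReal (4 / (k + 1 : ℝ) ^ 2) * ∫⁻ x in Ico (α - 1) α, f x := by
  set B := branch α s k
  have hBne : ∀ x ∈ B, x ≠ 0 := fun x hx => abs_pos.mp (abs_le_of_mem_branch h0 h1 hx).1
  have hs0 : s ≠ 0 := by rcases hs with rfl | rfl <;> norm_num
  have hT : ∀ x ∈ B, T α x = (s * x)⁻¹ - (k + 1) := by
    intro x hx
    have habs : |x| = s * x := by
      have := hx.2.1
      rcases hs with rfl | rfl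
      · rw [abs_of_pos (by linarith), one_mul]
      · rw [abs_of_neg (by linarith), neg_one_mul]
    rw [T_of_ne (hBne x hx), hx.2.2, habs, one_div]
    push_cast; ring
  have hder : ∀ x ∈ B, HasDerivWithinAt (fun x => (s * x)⁻¹ - (k + 1 : ℝ))
      (-(s * 1) / (s * x) ^ 2) B x := by
    intro x hx
    exact (((((hasDerivAt_id x).const_mul s).inv
      (mul_ne_zero hs0 (hBne x hx))).sub_const _).hasDerivWithinAt)
  have hinj : InjOn (fun x => (s * x)⁻¹ - (k + 1 : ℝ)) B := by
    intro x _ y _ h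
    exact mul_left_cancel₀ hs0 (inv_injective (sub_left_injective h))
  have himg : (fun x => (s * x)⁻¹ - (k + 1 : ℝ)) '' B ⊆ Ico (α - 1) α := by
    rintro _ ⟨x, hx, rfl⟩
    simp only
    rw [← hT x hx]
    exact T_mem (hBne x hx)
  calc ∫⁻ x in B, f (T α x)
      ≤ ∫⁻ x in B, ENNReal.ofReal (4 / (k + 1 : ℝ) ^ 2) *
          (ENNReal.ofReal |-(s * 1) / (s * x) ^ 2| * f ((s * x)⁻¹ - (k + 1))) := by
        refine setLIntegral_mono' (measurableSet_branch α s k) fun x hx => ?_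
        rw [hT x hx, ← mul_assoc, ← ENNReal.ofReal_mul (by positivity)]
        refine le_mul_of_one_le_left zero_le ?_
        rw [ENNReal.one_le_ofReal]
        obtain ⟨hp, hle⟩ := abs_le_of_mem_branch h0 h1 hx
        have e : |-(s * 1) / (s * x) ^ 2| = 1 / |x| ^ 2 := by
          rcases hs with rfl | rfl <;> simp [abs_div]
        rw [e, div_mul_div_comm, mul_one, le_div_iff₀ (by positivity), one_mul, ← mul_pow]
        have h5 : (k + 1 : ℝ) * |x| ≤ 2 := by
          rw [le_div_iff₀ (by positivity)] at hle; linarith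
        have h6 : 0 ≤ (k + 1 : ℝ) * |x| := by positivity
        nlinarith
    _ = ENNReal.ofReal (4 / (k + 1 : ℝ) ^ 2) *
          ∫⁻ x in (fun x => (s * x)⁻¹ - (k + 1 : ℝ)) '' B, f x := by
        rw [lintegral_const_mul' _ _ ENNReal.ofReal_ne_top,
          lintegral_image_eq_lintegral_abs_deriv_mul (measurableSet_branch α s k) hder hinj]
    _ ≤ _ := by gcongr

/-- The map `T α` does not increase integrals by more than a constant factor. -/
theorem exists_lintegral_comp_T_le {α : ℝ} (h0 : 0 < α) (h1 : α ≤ 1) :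
    ∃ C : ℝ, 1 ≤ C ∧ ∀ f : ℝ → ENNReal, ∫⁻ x in Ico (α - 1) α, f (T α x) ≤
      ENNReal.ofReal C * ∫⁻ x in Ico (α - 1) α, f x := by
  set D : ENNReal := ∑' k : ℕ, ENNReal.ofReal (4 / (k + 1 : ℝ) ^ 2)
  have hD : D ≠ ⊤ := by
    refine Summable.tsum_ofReal_ne_top ?_
    have := (summable_nat_add_iff 1).mpr (Real.summable_one_div_nat_pow.mpr one_lt_two)
    exact (this.mul_left 4).congr fun k => by push_cast; ring
  have h2D : D + D ≠ ⊤ := ENNReal.add_ne_top.mpr ⟨hD, hD⟩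
  refine ⟨max 1 (D + D).toReal, le_max_left _ _, fun f => ?_⟩
  have hle : D + D ≤ ENNReal.ofReal (max 1 (D + D).toReal) :=
    ENNReal.le_ofReal_iff_toReal_le h2D (by positivity) |>.mpr (le_max_right _ _)
  have hside : ∀ s : ℝ, s = 1 ∨ s = -1 → ∫⁻ x in ⋃ k, branch α s k, f (T α x) ≤
      D * ∫⁻ x in Ico (α - 1) α, f x := by
    intro s hs
    refine (lintegral_iUnion_le _ _).trans ?_
    rw [← ENNReal.tsum_mul_right]
    exact ENNReal.tsum_le_tsum fun k => lintegral_branch_le h0 h1 hs k f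
  have hsub : Ico (α - 1) α ⊆ {0} ∪ ((⋃ k, branch α 1 k) ∪ ⋃ k, branch α (-1) k) := by
    intro x hx
    rcases eq_or_ne x 0 with rfl | hx0
    · exact Or.inl rfl
    · obtain ⟨k, hk | hk⟩ := exists_mem_branch h0 h1 hx hx0
      · exact Or.inr (Or.inl (mem_iUnion.mpr ⟨k, hk⟩))
      · exact Or.inr (Or.inr (mem_iUnion.mpr ⟨k, hk⟩))
  calc ∫⁻ x in Ico (α - 1) α, f (T α x)
      ≤ ∫⁻ x in {0} ∪ ((⋃ k, branch α 1 k) ∪ ⋃ k, branch α (-1) k), f (T α x) :=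
        lintegral_mono_set hsub
    _ ≤ 0 + (D * (∫⁻ x in Ico (α - 1) α, f x) + D * ∫⁻ x in Ico (α - 1) α, f x) := by
        refine (lintegral_union_le _ _ _).trans (add_le_add ?_ ?_)
        · simp
        · exact (lintegral_union_le _ _ _).trans
            (add_le_add (hside 1 (Or.inl rfl)) (hside (-1) (Or.inr rfl)))
    _ ≤ _ := by
        rw [zero_add, ← add_mul]
        gcongr

theorem lintegral_comp_iterate_T_le {α C : ℝ}
    (hC : ∀ f : ℝ → ENNReal, ∫⁻ x in Ico (α - 1) α, f (T α x) ≤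
      ENNReal.ofReal C * ∫⁻ x in Ico (α - 1) α, f x) (f : ℝ → ENNReal) (j : ℕ) :
    ∫⁻ x in Ico (α - 1) α, f ((T α)^[j] x) ≤
      ENNReal.ofReal C ^ j * ∫⁻ x in Ico (α - 1) α, f x := by
  induction j with
  | zero => simp
  | succ j ih =>
    have := hC fun x => f ((T α)^[j] x)
    simp only [← Function.iterate_succ_apply] at this
    calc _ ≤ _ := this
      _ ≤ ENNReal.ofReal C * (ENNReal.ofReal C ^ j * ∫⁻ x in Ico (α - 1) α, f x) := by gcongr
      _ = _ := by rw [pow_succ]; ring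

theorem lintegral_abs_rpow_ne_top (α : ℝ) :
    ∫⁻ x in Ico (α - 1) α, ENNReal.ofReal (|x| ^ (-(1 / 2) : ℝ)) ≠ ⊤ := by
  have h : IntervalIntegrable (fun x : ℝ => |x| ^ (-(1 / 2) : ℝ)) volume (α - 1) α := by
    refine intervalIntegrable_of_even (fun x => by rw [abs_neg]) fun x hx => ?_
    refine (intervalIntegral.intervalIntegrable_rpow' (by norm_num :
      (-1 : ℝ) < -(1 / 2))).congr ?_
    intro y hy
    rw [uIoc_of_le hx.le] at hy
    simp only
    rw [abs_of_pos hy.1]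
  rw [intervalIntegrable_iff_integrableOn_Ico_of_le (by linarith)] at h
  have h2 := h.2
  rw [hasFiniteIntegral_iff_ofReal] at h2
  · exact h2.ne
  · exact Eventually.of_forall fun x => by positivity

theorem log_one_div_le {u M : ℝ} (hu : 0 ≤ u) (hM : 0 ≤ M) :
    Real.log (1 / u) ≤ M + 2 * Real.exp (-M / 2) * u ^ (-(1 / 2) : ℝ) := by
  rcases eq_or_lt_of_le hu with rfl | h
  · have : (0 : ℝ) ≤ 2 * Real.exp (-M / 2) * 0 ^ (-(1 / 2) : ℝ) := by positivity
    simpa using add_nonneg hM this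
  · have h1 : Real.log (Real.exp (-M) / u) ≤ (Real.exp (-M) / u) ^ (1 / 2 : ℝ) / (1 / 2) :=
      Real.log_le_rpow_div (by positivity) (by norm_num)
    rw [Real.log_div (Real.exp_ne_zero _) h.ne', Real.log_exp,
      Real.div_rpow (Real.exp_pos _).le hu, ← Real.exp_mul] at h1
    rw [one_div, Real.log_inv, Real.rpow_neg hu]
    have e : -M * (1 / 2) = -M / 2 := by ring
    rw [e] at h1
    have : 2 * Real.exp (-M / 2) * (u ^ (1 / 2 : ℝ))⁻¹ =
        Real.exp (-M / 2) / u ^ (1 / 2 : ℝ) / (1 / 2) := by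
      rw [div_div_eq_mul_div]; ring
    rw [this]
    linarith

/-- Exponential decay of the products of the absolute values along an orbit. -/
theorem exists_betaProd_le {α : ℝ} (h0 : 0 < α) (h1 : α ≤ 1) :
    ∃ B r : ℝ, 0 < B ∧ 0 < r ∧ r < 1 ∧
      ∀ x ∈ Ico (α - 1) α, ∀ j, betaProd α x j ≤ B * r ^ j := by
  rcases eq_or_lt_of_le h1 with rfl | hlt
  · refine ⟨2, 3 / 4, by norm_num, by norm_num, by norm_num, fun x hx j => ?_⟩
    have hone : ∀ x ∈ Ico (1 - 1 : ℝ) 1, |x| ≤ 1 := fun x hx => (abs_lt_one one_pos le_rfl hx).le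
    have htwo : ∀ x ∈ Ico (1 - 1 : ℝ) 1, |x| * |T 1 x| ≤ 1 / 2 := by
      intro x hx
      rcases eq_or_ne x 0 with rfl | hx0
      · simp
      have hpos : 0 < x := lt_of_le_of_ne (by linarith [hx.1]) hx0.symm
      have hT := T_mem (α := 1) hx0
      have hTe := T_of_ne (α := 1) hx0
      have hd : 1 ≤ digit 1 x := by
        rw [digit, Int.le_floor, abs_of_pos hpos]
        have : 1 ≤ 1 / x := by rw [le_div_iff₀ hpos, one_mul]; exact hx.2.le
        push_cast
        linarith
      have hd' : (1 : ℝ) ≤ digit 1 x := by exact_mod_cast hd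
      rw [abs_of_pos hpos] at hTe ⊢
      rw [abs_of_nonneg (by linarith [hT.1])]
      have hxx : x * (1 / x) = 1 := by field_simp
      have : x * T 1 x = 1 - x * digit 1 x := by rw [hTe, mul_sub, hxx]
      nlinarith [hT.1, hT.2]
    have hpair : ∀ j, ∀ x ∈ Ico (1 - 1 : ℝ) 1, betaProd 1 x j ≤ 2 * (3 / 4) ^ j ∧
        betaProd 1 x (j + 1) ≤ 2 * (3 / 4) ^ (j + 1) := by
      intro j
      induction j with
      | zero =>
        intro x hx
        have := hone x hx
        constructor
        · norm_num [betaProd]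
        · norm_num [betaProd]
          linarith
      | succ j ih =>
        intro x hx
        refine ⟨(ih x hx).2, ?_⟩
        rw [betaProd_succ, betaProd_succ, ← mul_assoc]
        have h3 := (ih _ (T_mapsTo 1 (T_mapsTo 1 hx))).1
        have h4 := htwo x hx
        calc |x| * |T 1 x| * betaProd 1 (T 1 (T 1 x)) j ≤ 1 / 2 * (2 * (3 / 4) ^ j) :=
              mul_le_mul h4 h3 (Finset.prod_nonneg fun i _ => abs_nonneg _) (by norm_num)
          _ ≤ 2 * (3 / 4) ^ (j + 1 + 1) := by
              have : (0 : ℝ) < (3 / 4) ^ j := by positivity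
              rw [pow_succ, pow_succ]; nlinarith
    exact (hpair j x hx).1
  · refine ⟨1, max α (1 - α), one_pos, lt_max_of_lt_left h0, max_lt hlt (by linarith),
      fun x hx j => ?_⟩
    rw [one_mul, betaProd]
    calc ∏ i ∈ Finset.range j, |(T α)^[i] x| ≤ ∏ i ∈ Finset.range j, max α (1 - α) := by
          refine Finset.prod_le_prod (fun i _ => abs_nonneg _) fun i _ => ?_
          have := iterate_mem hx i
          rw [abs_le]
          constructor
          · linarith [this.1, le_max_right α (1 - α)]
          · linarith [this.2, le_max_left α (1 - α)]
      _ = _ := by simp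

theorem log_one_div_abs_nonneg {α x : ℝ} (h0 : 0 < α) (h1 : α ≤ 1) (hx : x ∈ Ico (α - 1) α) :
    0 ≤ Real.log (1 / |x|) := by
  rw [one_div, Real.log_inv, neg_nonneg]
  exact Real.log_nonpos (abs_nonneg x) (abs_lt_one h0 h1 hx).le

theorem lintegral_log_iterate_le {α C : ℝ} (hC1 : 1 ≤ C)
    (hC : ∀ f : ℝ → ENNReal, ∫⁻ x in Ico (α - 1) α, f (T α x) ≤
      ENNReal.ofReal C * ∫⁻ x in Ico (α - 1) α, f x) (j : ℕ) :
    ∫⁻ x in Ico (α - 1) α, ENNReal.ofReal (Real.log (1 / |(T α)^[j] x|)) ≤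
      ENNReal.ofReal (2 * (j * Real.log C)) +
        ENNReal.ofReal 2 * ∫⁻ x in Ico (α - 1) α, ENNReal.ofReal (|x| ^ (-(1 / 2) : ℝ)) := by
  have hL : 0 ≤ Real.log C := Real.log_nonneg hC1
  have hM : 0 ≤ 2 * (j * Real.log C) := by positivity
  have hexp : Real.exp (-(2 * (j * Real.log C)) / 2) = (C ^ j)⁻¹ := by
    have : -(2 * (j * Real.log C)) / 2 = -(j * Real.log C) := by ring
    rw [this, Real.exp_neg, Real.exp_nat_mul, Real.exp_log (by linarith)]
  have hCj : C ^ j ≠ 0 := by positivity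
  calc _ ≤ ∫⁻ x in Ico (α - 1) α, (ENNReal.ofReal (2 * (j * Real.log C)) +
          ENNReal.ofReal (2 * (C ^ j)⁻¹) * ENNReal.ofReal (|(T α)^[j] x| ^ (-(1 / 2) : ℝ))) := by
        refine lintegral_mono fun x => ?_
        rw [← ENNReal.ofReal_mul (by positivity), ← ENNReal.ofReal_add hM (by positivity), ← hexp]
        exact ENNReal.ofReal_le_ofReal (log_one_div_le (abs_nonneg _) hM)
    _ = ENNReal.ofReal (2 * (j * Real.log C)) + ENNReal.ofReal (2 * (C ^ j)⁻¹) *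
          ∫⁻ x in Ico (α - 1) α, ENNReal.ofReal (|(T α)^[j] x| ^ (-(1 / 2) : ℝ)) := by
        rw [lintegral_add_left measurable_const, lintegral_const_mul' _ _ ENNReal.ofReal_ne_top]
        simp
    _ ≤ ENNReal.ofReal (2 * (j * Real.log C)) + ENNReal.ofReal (2 * (C ^ j)⁻¹) *
          (ENNReal.ofReal C ^ j * ∫⁻ x in Ico (α - 1) α, ENNReal.ofReal (|x| ^ (-(1 / 2) : ℝ))) := by
        gcongr
        exact lintegral_comp_iterate_T_le hC (fun x => ENNReal.ofReal (|x| ^ (-(1 / 2) : ℝ))) j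
    _ = _ := by
        rw [← mul_assoc (ENNReal.ofReal (2 * (C ^ j)⁻¹)), ← ENNReal.ofReal_pow (by linarith),
          ← ENNReal.ofReal_mul (by positivity), mul_assoc 2 (C ^ j)⁻¹, inv_mul_cancel₀ hCj, mul_one]

theorem tsum_lintegral_wiltonTerm_ne_top {α : ℝ} (h0 : 0 < α) (h1 : α ≤ 1) :
    ∑' j, ∫⁻ x in Ico (α - 1) α, ‖wiltonTerm α x j‖ₑ ≠ ⊤ := by
  obtain ⟨C, hC1, hC⟩ := exists_lintegral_comp_T_le h0 h1
  obtain ⟨B, r, hB, hr0, hr1, hβ⟩ := exists_betaProd_le h0 h1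
  set K := ∫⁻ x in Ico (α - 1) α, ENNReal.ofReal (|x| ^ (-(1 / 2) : ℝ)) with hK
  have hKt : K ≠ ⊤ := lintegral_abs_rpow_ne_top α
  have hterm : ∀ j, ∫⁻ x in Ico (α - 1) α, ‖wiltonTerm α x j‖ₑ ≤
      ENNReal.ofReal (B * r ^ j * (2 * (j * Real.log C))) +
        ENNReal.ofReal (B * r ^ j) * (ENNReal.ofReal 2 * K) := by
    intro j
    calc _ ≤ ∫⁻ x in Ico (α - 1) α, ENNReal.ofReal (B * r ^ j) *
            ENNReal.ofReal (Real.log (1 / |(T α)^[j] x|)) := by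
          refine setLIntegral_mono' measurableSet_Ico fun x hx => ?_
          have hlog := log_one_div_abs_nonneg h0 h1 (iterate_mem hx j)
          rw [← ENNReal.ofReal_mul (by positivity), Real.enorm_eq_ofReal_abs, wiltonTerm, abs_mul,
            abs_mul, abs_pow, abs_neg, abs_one, one_pow, one_mul, abs_of_nonneg hlog,
            abs_of_nonneg (Finset.prod_nonneg fun i _ => abs_nonneg _)]
          exact ENNReal.ofReal_le_ofReal (mul_le_mul_of_nonneg_right (hβ x hx j) hlog)
      _ = ENNReal.ofReal (B * r ^ j) *
            ∫⁻ x in Ico (α - 1) α, ENNReal.ofReal (Real.log (1 / |(T α)^[j] x|)) :=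
          lintegral_const_mul' _ _ ENNReal.ofReal_ne_top
      _ ≤ ENNReal.ofReal (B * r ^ j) *
            (ENNReal.ofReal (2 * (j * Real.log C)) + ENNReal.ofReal 2 * K) := by
          gcongr
          exact lintegral_log_iterate_le hC1 hC j
      _ = _ := by rw [mul_add, ← ENNReal.ofReal_mul (by positivity)]
  refine ne_top_of_le_ne_top ?_ (ENNReal.tsum_le_tsum hterm)
  rw [ENNReal.tsum_add, ENNReal.tsum_mul_right]
  refine ENNReal.add_ne_top.mpr ⟨Summable.tsum_ofReal_ne_top ?_, ENNReal.mul_ne_top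
    (Summable.tsum_ofReal_ne_top ?_) (ENNReal.mul_ne_top ENNReal.ofReal_ne_top hKt)⟩
  · have := (summable_pow_mul_geometric_of_norm_lt_one 1 (r := r)
      (by rw [Real.norm_of_nonneg hr0.le]; exact hr1)).mul_left (B * 2 * Real.log C)
    exact this.congr fun j => by ring
  · exact (summable_geometric_of_lt_one hr0.le hr1).mul_left B

/-- The Wilton series converges absolutely almost everywhere. -/
theorem ae_summable_wiltonTerm {α : ℝ} (h0 : 0 < α) (h1 : α ≤ 1) :
    ∀ᵐ x ∂volume.restrict (Ico (α - 1) α), Summable (wiltonTerm α x) := by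
  have hm : ∀ j, Measurable fun x => ‖wiltonTerm α x j‖ₑ := fun j =>
    (measurable_wiltonTerm α j).enorm
  have h := tsum_lintegral_wiltonTerm_ne_top h0 h1
  rw [← lintegral_tsum fun j => (hm j).aemeasurable] at h
  filter_upwards [ae_lt_top (Measurable.tsum hm) h] with x hx
  exact (tsum_enorm_ne_top_iff_summable_norm.mp hx.ne).of_norm

theorem integrableOn_wilton {α : ℝ} (h0 : 0 < α) (h1 : α ≤ 1) :
    IntegrableOn (wilton α) (Ico (α - 1) α) := by
  refine ⟨(measurable_wilton α).aestronglyMeasurable, ?_⟩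
  have h := tsum_lintegral_wiltonTerm_ne_top h0 h1
  rw [← lintegral_tsum fun j => (measurable_wiltonTerm α j).enorm.aemeasurable] at h
  refine lt_of_le_of_lt (lintegral_mono_ae ?_) h.lt_top
  filter_upwards [ae_summable_wiltonTerm h0 h1, ae_restrict_mem measurableSet_Ico] with x hx hI
  rw [wilton_of_mem hI, wiltonSeries_eq, tsum_eq_of_summable_unconditional hx]
  exact enorm_tsum_le_tsum_enorm

theorem intervalIntegrable_wilton {α : ℝ} (h0 : 0 < α) (h1 : α ≤ 1) (a b : ℝ) :
    IntervalIntegrable (wilton α) volume a b := by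
  refine (wilton_periodic α).intervalIntegrable one_ne_zero (t := α - 1) ?_ a b
  rw [intervalIntegrable_iff_integrableOn_Ico_of_le (by linarith), sub_add_cancel]
  exact integrableOn_wilton h0 h1

theorem ae_wilton_eq {α : ℝ} (h0 : 0 < α) (h1 : α ≤ 1) :
    ∀ᵐ x ∂volume.restrict (Ico (α - 1) α),
      wilton α x = -Real.log |x| - |x| * wiltonSeries α (T α x) := by
  have hne : ∀ᵐ x ∂volume.restrict (Ico (α - 1) α), x ≠ 0 := by
    refine ae_restrict_of_ae ?_
    simp [ae_iff, measure_singleton]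
  filter_upwards [ae_summable_wiltonTerm h0 h1, ae_restrict_mem measurableSet_Ico, hne]
    with x hx hI h
  rw [wilton_eq_of_summable hI h ⟨_, hx.hasSum.mono_left (SummationFilter.LeAtTop.le_atTop)⟩,
    wilton_one_div_abs h]

theorem integrableOn_wiltonSeries_comp_T {α : ℝ} (h0 : 0 < α) (h1 : α ≤ 1) :
    IntegrableOn (fun x => wiltonSeries α (T α x)) (Ico (α - 1) α) := by
  obtain ⟨C, -, hC⟩ := exists_lintegral_comp_T_le h0 h1
  refine ⟨((measurable_wiltonSeries α).comp (measurable_T α)).aestronglyMeasurable, ?_⟩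
  refine lt_of_le_of_lt (hC fun y => ‖wiltonSeries α y‖ₑ) (ENNReal.mul_lt_top
    ENNReal.ofReal_lt_top ?_)
  have := (integrableOn_wilton h0 h1).2
  rwa [HasFiniteIntegral, setLIntegral_congr_fun measurableSet_Ico
    fun x hx => by rw [wilton_of_mem hx]] at this

/-- The logarithmic singularity at `0`. -/
theorem sideTop_zero {α σ : ℝ} (h0 : 0 < α) (h1 : α ≤ 1) (hσ : σ = 1 ∨ σ = -1)
    (hin : SideIn α 0 σ) : SideTop α 0 σ 1 := by
  obtain ⟨δ, hδ, hsub⟩ := mem_nhdsGT_iff_exists_Ioc_subset.mp hin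
  have hI : Ioc 0 δ ⊆ (fun u => σ * u) ⁻¹' Ico (α - 1) α := by
    intro u hu
    simpa using hsub hu
  have hmp : MeasurePreserving (fun u : ℝ => σ * u) := by
    rcases hσ with rfl | rfl
    · simp only [one_mul]
      exact MeasurePreserving.id volume
    · simpa using Measure.measurePreserving_neg (volume : Measure ℝ)
  have hemb : MeasurableEmbedding (fun u : ℝ => σ * u) :=
    measurableEmbedding_mulLeft₀ (by rcases hσ with rfl | rfl <;> norm_num)
  have hW : IntegrableOn (fun u => wilton α (σ * u)) (Ioc 0 δ) :=
    ((hmp.integrableOn_comp_preimage hemb).mpr (integrableOn_wilton h0 h1)).mono_set hI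
  have hQ : IntegrableOn (fun u => |wiltonSeries α (T α (σ * u))|) (Ioc 0 δ) :=
    (((hmp.integrableOn_comp_preimage hemb).mpr
      (integrableOn_wiltonSeries_comp_T h0 h1)).mono_set hI).abs
  have hae : ∀ᵐ u : ℝ, σ * u ∈ Ico (α - 1) α → wilton α (σ * u) =
      -Real.log |σ * u| - |σ * u| * wiltonSeries α (T α (σ * u)) :=
    hmp.quasiMeasurePreserving.ae ((ae_restrict_iff' measurableSet_Ico).mp (ae_wilton_eq h0 h1))
  set K := ∫ u in Ioc 0 δ, |wiltonSeries α (T α (σ * u))|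
  have hlim : Tendsto (fun h : ℝ => -Real.log h + (1 - K)) (𝓝[>] 0) atTop :=
    tendsto_atTop_add_const_right _ _ (tendsto_neg_atBot_atTop.comp Real.tendsto_log_nhdsGT_zero)
  refine tendsto_atTop_mono' _ ?_ hlim
  filter_upwards [Ioo_mem_nhdsGT hδ] with h hh
  have hss : Ioc 0 h ⊆ Ioc 0 δ := Ioc_subset_Ioc_right hh.2.le
  have i1 : IntegrableOn (fun u => -Real.log u) (Ioc 0 h) :=
    ((intervalIntegrable_iff_integrableOn_Ioc_of_le hh.1.le).mp
      intervalIntegral.intervalIntegrable_log').neg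
  have i2 : IntegrableOn (fun u => h * |wiltonSeries α (T α (σ * u))|) (Ioc 0 h) :=
    (hQ.mono_set hss).const_mul _
  have hmono : ∫ u in Ioc 0 h, (-Real.log u - h * |wiltonSeries α (T α (σ * u))|) ≤
      ∫ u in Ioc 0 h, 1 * wilton α (0 + σ * u) := by
    simp only [one_mul, zero_add]
    refine integral_mono_ae (i1.sub i2) (hW.mono_set hss) ?_
    refine (ae_restrict_iff' measurableSet_Ioc).mpr ?_
    filter_upwards [hae] with u hu hu2
    have habs : |σ * u| = u := by
      rcases hσ with rfl | rfl <;> simp [abs_of_pos hu2.1]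
    rw [hu (hI (hss hu2)), habs]
    have h3 : u * wiltonSeries α (T α (σ * u)) ≤ u * |wiltonSeries α (T α (σ * u))| :=
      mul_le_mul_of_nonneg_left (le_abs_self _) hu2.1.le
    have h4 : u * |wiltonSeries α (T α (σ * u))| ≤ h * |wiltonSeries α (T α (σ * u))| :=
      mul_le_mul_of_nonneg_right hu2.2 (abs_nonneg _)
    linarith
  rw [integral_sub i1 i2, integral_neg, integral_const_mul,
    ← intervalIntegral.integral_of_le (f := Real.log) hh.1.le, integral_log] at hmono
  have hK : ∫ u in Ioc 0 h, |wiltonSeries α (T α (σ * u))| ≤ K :=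
    setIntegral_mono_set hQ (Eventually.of_forall fun u => abs_nonneg _) hss.eventuallyLE
  have hK' := mul_le_mul_of_nonneg_left hK hh.1.le
  rw [one_div, inv_mul_eq_div, le_div_iff₀ hh.1]
  have e : (-Real.log h + (1 - K)) * h =
      -(h * Real.log h - 0 * Real.log 0 - h + 0) - h * K := by ring
  rw [e, intervalIntegral.integral_of_le hh.1.le]
  linarith

theorem integrableAt_side {w : ℝ → ℝ} {ξ σ a b : ℝ} (hσ : σ = 1 ∨ σ = -1) (hξ : ξ ∈ Ioo a b)
    (hw : IntegrableOn w (Ioo a b)) (s : ℝ) :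
    IntegrableAtFilter (fun u => s * w (ξ + σ * u)) (𝓝[>] 0) volume := by
  have hmp : MeasurePreserving (fun u : ℝ => ξ + σ * u) := by
    rcases hσ with rfl | rfl
    · simp only [one_mul]
      exact measurePreserving_add_left volume ξ
    · simp only [neg_one_mul, ← sub_eq_add_neg]
      exact Measure.measurePreserving_sub_left volume ξ
  have hemb : MeasurableEmbedding (fun u : ℝ => ξ + σ * u) :=
    (measurableEmbedding_addLeft ξ).comp
      (measurableEmbedding_mulLeft₀ (by rcases hσ with rfl | rfl <;> norm_num))
  refine ⟨(fun u : ℝ => ξ + σ * u) ⁻¹' Ioo a b, ?_,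
    ((hmp.integrableOn_comp_preimage hemb).mpr hw).const_mul s⟩
  refine nhdsWithin_le_nhds ((Continuous.continuousAt (by fun_prop)).preimage_mem_nhds ?_)
  simpa using Ioo_mem_nhds hξ.1 hξ.2

theorem integrableOn_wilton_Ioo {α : ℝ} (h0 : 0 < α) (h1 : α ≤ 1) (ξ : ℝ) :
    IntegrableOn (wilton α) (Ioo (ξ - 1) (ξ + 1)) :=
  ((intervalIntegrable_iff_integrableOn_Ioc_of_le (by linarith)).mp
    (intervalIntegrable_wilton h0 h1 (ξ - 1) (ξ + 1))).mono_set Ioo_subset_Ioc_self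

theorem sign_eps {σ ξ : ℝ} (hσ : σ = 1 ∨ σ = -1) (hξ : ξ ≠ 0) :
    -(σ * eps ξ) = 1 ∨ -(σ * eps ξ) = -1 := by
  rcases lt_or_gt_of_ne hξ with h | h <;> rcases hσ with rfl | rfl <;>
    simp [eps_of_neg, eps_of_pos, h]

theorem sideTop_neg_iff {α ξ σ s : ℝ} :
    (AvgTop fun u => -(s * wilton α (ξ + σ * u))) ↔ SideTop α ξ σ (-s) := by
  rw [SideTop]
  simp only [neg_mul]

/-- One-sided logarithmic behaviour at `T ξ` gives the opposite behaviour at `ξ`. -/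
theorem SideTop.of_map {α ξ σ s : ℝ} (h0 : 0 < α) (h1 : α ≤ 1) (hσ : σ = 1 ∨ σ = -1)
    (hs : s = 1 ∨ s = -1) (hξ : ξ ≠ 0) (hin : SideIn α ξ σ)
    (h : SideTop α (T α ξ) (-(σ * eps ξ)) s) : SideTop α ξ σ (-s) := by
  obtain ⟨ρ, C, hρ, rfl, hC⟩ := eventually_wilton_relation hσ hs hξ hin
  have hf := integrableAt_side (ξ := ξ) hσ ⟨by linarith, by linarith⟩
    (integrableOn_wilton_Ioo h0 h1 ξ) s
  have hg := integrableAt_side (ξ := T α ξ) (sign_eps hσ hξ) ⟨by linarith, by linarith⟩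
    (integrableOn_wilton_Ioo h0 h1 (T α ξ)) s
  exact sideTop_neg_iff.mp (AvgTop.transfer (abs_pos.mpr hξ) hρ hf hg hC h)

/-- One-sided logarithmic behaviour at `ξ` gives the opposite behaviour at `T ξ`. -/
theorem SideTop.map {α ξ σ s : ℝ} (hσ : σ = 1 ∨ σ = -1) (hs : s = 1 ∨ s = -1) (hξ : ξ ≠ 0)
    (hin : SideIn α ξ σ)
    (hf : IntegrableAtFilter (fun u => s * wilton α (ξ + σ * u)) (𝓝[>] 0) volume)
    (h : SideTop α ξ σ s) :
    IntegrableAtFilter (fun u => s * wilton α (T α ξ + -(σ * eps ξ) * u)) (𝓝[>] 0) volume ∧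
      SideTop α (T α ξ) (-(σ * eps ξ)) (-s) := by
  obtain ⟨ρ, C, hρ, rfl, hC⟩ := eventually_wilton_relation hσ hs hξ hin
  have ha := abs_pos.mpr hξ
  have hm : Measurable fun u => s * wilton α (T α ξ + -(σ * eps ξ) * u) :=
    ((measurable_wilton α).comp (by fun_prop)).const_mul s
  have hg := integrableAt_transfer ha hρ hf hm hC
  refine ⟨hg, sideTop_neg_iff.mp (AvgTop.transfer (inv_pos.mpr ha) ?_ hg hf
    (eventually_transfer_symm (f := fun u => s * wilton α (ξ + σ * u))
      (g := fun v => s * wilton α (T α ξ + -(σ * eps ξ) * v)) ha hρ hC) h)⟩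
  rcases hρ with h | h <;> simp [h]

theorem SideTop.of_iterate {α : ℝ} (h0 : 0 < α) (h1 : α ≤ 1) (k : ℕ) :
    ∀ ξ : ℝ, (∀ i < k, (T α)^[i] ξ ∈ Ioo (α - 1) α ∧ (T α)^[i] ξ ≠ 0) →
    ∃ τ : ℝ, (τ = 1 ∨ τ = -1) ∧ ∀ σ s : ℝ, (σ = 1 ∨ σ = -1) → (s = 1 ∨ s = -1) →
      SideTop α ((T α)^[k] ξ) (τ * σ) s → SideTop α ξ σ ((-1) ^ k * s) := by
  induction k with
  | zero => exact fun ξ _ => ⟨1, Or.inl rfl, fun σ s _ _ h => by simpa using h⟩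
  | succ k ih =>
    intro ξ hξ
    obtain ⟨τ, hτ, h⟩ := ih (T α ξ) fun i hi => by
      simpa only [Function.iterate_succ_apply] using hξ (i + 1) (by omega)
    obtain ⟨hI, hne⟩ : ξ ∈ Ioo (α - 1) α ∧ ξ ≠ 0 := hξ 0 (by omega)
    refine ⟨τ * -eps ξ, ?_, fun σ s hσ hs hk => ?_⟩
    · have := sign_eps (Or.inl rfl) hne
      rw [one_mul] at this
      rcases hτ with rfl | rfl
      · rwa [one_mul]
      · rcases this with h | h <;> rw [h] <;> simp
    · rw [Function.iterate_succ_apply] at hk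
      have e : τ * -eps ξ * σ = τ * -(σ * eps ξ) := by ring
      rw [e] at hk
      have hs' : (-1) ^ k * s = 1 ∨ (-1) ^ k * s = -1 := by
        rcases neg_one_pow_eq_or ℝ k with h | h <;> rcases hs with rfl | rfl <;> simp [h]
      have := (h _ s (sign_eps hσ hne) hs hk).of_map h0 h1 hσ hs' hne (sideIn_of_mem_Ioo hI)
      rwa [pow_succ, mul_neg_one, neg_mul]

theorem tendsto_nhdsNE_zero_iff {F : ℝ → ℝ} {l : Filter ℝ} :
    Tendsto F (𝓝[≠] 0) l ↔
      Tendsto F (𝓝[>] 0) l ∧ Tendsto (fun h => F (-h)) (𝓝[>] 0) l := by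
  have hneg : Tendsto (fun h : ℝ => -h) (𝓝[>] 0) (𝓝[<] 0) := by
    simpa using tendsto_neg_nhdsGT (a := (0 : ℝ))
  have hneg' : Tendsto (fun h : ℝ => -h) (𝓝[<] 0) (𝓝[>] 0) := by
    simpa using tendsto_neg_nhdsLT (a := (0 : ℝ))
  rw [← nhdsLT_sup_nhdsGT, tendsto_sup, and_comm]
  refine and_congr_right fun _ => ⟨fun h => h.comp hneg, fun h => ?_⟩
  simpa [Function.comp_def] using h.comp hneg'

/-- The average of the Wilton function over the interval of length `h` on the side `σ` of `ξ`. -/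
def sideAvg (α ξ σ h : ℝ) : ℝ := (1 / h) * ∫ u in (0 : ℝ)..h, wilton α (ξ + σ * u)

theorem sideTop_iff {α ξ σ s : ℝ} :
    SideTop α ξ σ s ↔ Tendsto (fun h => s * sideAvg α ξ σ h) (𝓝[>] 0) atTop := by
  rw [SideTop, AvgTop]
  simp only [intervalIntegral.integral_const_mul, sideAvg, mul_left_comm]

theorem one_div_mul_integral (α ξ h : ℝ) :
    (1 / h) * ∫ t in ξ..(ξ + h), wilton α t = sideAvg α ξ 1 h := by
  rw [sideAvg]
  simp only [one_mul]
  rw [intervalIntegral.integral_comp_add_left, add_zero]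

theorem one_div_neg_mul_integral (α ξ h : ℝ) :
    (1 / -h) * ∫ t in ξ..(ξ + -h), wilton α t = sideAvg α ξ (-1) h := by
  rw [sideAvg]
  simp only [neg_one_mul, ← sub_eq_add_neg]
  rw [intervalIntegral.integral_comp_sub_left, sub_zero, intervalIntegral.integral_symm,
    one_div, inv_neg, neg_mul_neg, one_div]

theorem sideAvg_one_neg (α ξ h : ℝ) : sideAvg α ξ 1 (-h) = sideAvg α ξ (-1) h := by
  rw [← one_div_mul_integral, one_div_neg_mul_integral]

theorem isTypeB_iff {α ξ : ℝ} : IsTypeB (wilton α) ξ ↔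
    (∃ a b : ℝ, ξ ∈ Ioo a b ∧ IntegrableOn (wilton α) (Ioo a b)) ∧
    ∃ s : ℝ, (s = 1 ∨ s = -1) ∧ SideTop α ξ 1 s ∧ SideTop α ξ (-1) s := by
  rw [IsTypeB]
  refine and_congr_right fun _ => ?_
  rw [tendsto_nhdsNE_zero_iff, tendsto_nhdsNE_zero_iff]
  simp only [one_div_mul_integral, sideAvg_one_neg, sideTop_iff, or_and_right,
    exists_or, exists_eq_left, one_mul, neg_one_mul, tendsto_neg_atTop_iff]

theorem isTypeA_iff {α ξ : ℝ} : IsTypeA (wilton α) ξ ↔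
    (∃ a b : ℝ, ξ ∈ Ioo a b ∧ IntegrableOn (wilton α) (Ioo a b)) ∧
    ∃ s : ℝ, (s = 1 ∨ s = -1) ∧ SideTop α ξ 1 s ∧ SideTop α ξ (-1) (-s) := by
  rw [IsTypeA]
  refine and_congr_right fun _ => ?_
  have key : ∀ l : Filter ℝ,
      Tendsto (fun h : ℝ => (1 / |h|) * ∫ t in ξ..(ξ + h), wilton α t) (𝓝[≠] 0) l ↔
        Tendsto (sideAvg α ξ 1) (𝓝[>] 0) l ∧
          Tendsto (fun h => -sideAvg α ξ (-1) h) (𝓝[>] 0) l := by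
    intro l
    rw [tendsto_nhdsNE_zero_iff]
    refine and_congr (tendsto_congr' ?_) (tendsto_congr' ?_)
    · filter_upwards [self_mem_nhdsWithin] with h hh
      rw [abs_of_pos hh, one_div_mul_integral]
    · filter_upwards [self_mem_nhdsWithin] with h hh
      rw [abs_neg, abs_of_pos hh, ← one_div_neg_mul_integral, one_div, one_div, inv_neg, neg_mul,
        neg_neg]
  rw [key, key]
  simp only [sideTop_iff, or_and_right, exists_or, exists_eq_left, one_mul, neg_one_mul,
    tendsto_neg_atTop_iff, tendsto_neg_atBot_iff, neg_neg]

theorem IsTypeA.not_isTypeB {α ξ : ℝ} (hA : IsTypeA (wilton α) ξ) : ¬ IsTypeB (wilton α) ξ := by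
  intro hB
  obtain ⟨-, s, hs, h1, h2⟩ := isTypeA_iff.mp hA
  obtain ⟨-, t, ht, h3, h4⟩ := isTypeB_iff.mp hB
  rcases hs with rfl | rfl <;> rcases ht with rfl | rfl
  · exact h4.not_neg h2
  · exact h1.not_neg h3
  · exact h3.not_neg h1
  · exact h4.not_neg h2

theorem isTypeB_of_iterate {α ξ s : ℝ} {k : ℕ} (h0 : 0 < α) (h1 : α ≤ 1)
    (hξ : ∀ i < k, (T α)^[i] ξ ∈ Ioo (α - 1) α ∧ (T α)^[i] ξ ≠ 0) (hs : s = 1 ∨ s = -1)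
    (hr : SideTop α ((T α)^[k] ξ) 1 s) (hl : SideTop α ((T α)^[k] ξ) (-1) s) :
    IsTypeB (wilton α) ξ := by
  obtain ⟨τ, hτ, h⟩ := SideTop.of_iterate h0 h1 k ξ hξ
  have hs' : (-1) ^ k * s = 1 ∨ (-1) ^ k * s = -1 := by
    rcases neg_one_pow_eq_or ℝ k with h | h <;> rcases hs with rfl | rfl <;> simp [h]
  refine isTypeB_iff.mpr ⟨⟨ξ - 1, ξ + 1, ⟨by linarith, by linarith⟩,
    integrableOn_wilton_Ioo h0 h1 ξ⟩, _, hs', h 1 s (Or.inl rfl) hs ?_,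
    h (-1) s (Or.inr rfl) hs ?_⟩
  · rcases hτ with rfl | rfl <;> simpa
  · rcases hτ with rfl | rfl <;> simpa

theorem isTypeA_of_iterate {α ξ s : ℝ} {k : ℕ} (h0 : 0 < α) (h1 : α ≤ 1)
    (hξ : ∀ i < k, (T α)^[i] ξ ∈ Ioo (α - 1) α ∧ (T α)^[i] ξ ≠ 0) (hs : s = 1 ∨ s = -1)
    (hr : SideTop α ((T α)^[k] ξ) 1 s) (hl : SideTop α ((T α)^[k] ξ) (-1) (-s)) :
    IsTypeA (wilton α) ξ := by
  obtain ⟨τ, hτ, h⟩ := SideTop.of_iterate h0 h1 k ξ hξ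
  have hns : -s = 1 ∨ -s = -1 := by rcases hs with rfl | rfl <;> simp
  have hint : ∃ a b : ℝ, ξ ∈ Ioo a b ∧ IntegrableOn (wilton α) (Ioo a b) :=
    ⟨ξ - 1, ξ + 1, ⟨by linarith, by linarith⟩, integrableOn_wilton_Ioo h0 h1 ξ⟩
  have hsign : ∀ t : ℝ, t = 1 ∨ t = -1 → (-1) ^ k * t = 1 ∨ (-1) ^ k * t = -1 := by
    intro t ht
    rcases neg_one_pow_eq_or ℝ k with h | h <;> rcases ht with rfl | rfl <;> simp [h]
  rcases hτ with rfl | rfl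
  · refine isTypeA_iff.mpr ⟨hint, _, hsign s hs, h 1 s (Or.inl rfl) hs (by simpa), ?_⟩
    have := h (-1) (-s) (Or.inr rfl) hns (by simpa)
    rwa [mul_neg] at this
  · refine isTypeA_iff.mpr ⟨hint, _, hsign (-s) hns, h 1 (-s) (Or.inl rfl) hns (by simpa), ?_⟩
    have := h (-1) s (Or.inr rfl) hs (by simpa)
    rwa [mul_neg, neg_neg]

/-- The behaviour of the Wilton function at the endpoints, for rational `α ∈ (0, 1)`. -/
theorem sideTop_endpoint {α x σ : ℝ} {n : ℕ} (h0 : 0 < α) (h1 : α < 1)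
    (hαQ : α ∈ range ((↑) : ℚ → ℝ)) (hx : x = α ∨ x = α - 1) (hσ : σ = 1 ∨ σ = -1)
    (hin : SideIn α x σ) (hn : FirstZero α x n) : SideTop α x σ ((-1) ^ n) := by
  have hx0 : x ≠ 0 := by
    rcases hx with rfl | rfl
    · exact h0.ne'
    · exact (by linarith : α - 1 < 0).ne
  cases n with
  | zero => exact (hx0 hn.1).elim
  | succ n =>
    rw [add_comm] at hn
    have hn' := hn.iterate
    rw [Function.iterate_one] at hn'
    obtain ⟨τ, hτ, h⟩ := SideTop.of_iterate h0 h1.le n (T α x) fun i hi => by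
      have hmem := iterate_mem (T_mem (α := α) hx0) i
      refine ⟨⟨lt_of_le_of_ne hmem.1 (Ne.symm ?_), hmem.2⟩, hn'.2 i hi⟩
      rw [← Function.iterate_succ_apply]
      exact iterate_endpoint_ne h0 h1 hαQ hx i
    have hσ' := sign_eps hσ hx0
    have h00 : (0 : ℝ) ∈ Ioo (α - 1) α := ⟨by linarith, h0⟩
    have hτσ : τ * -(σ * eps x) = 1 ∨ τ * -(σ * eps x) = -1 := by
      rcases hτ with h | h <;> rcases hσ' with h' | h' <;> rw [h, h'] <;> simp
    have hz : SideTop α ((T α)^[n] (T α x)) (τ * -(σ * eps x)) 1 := by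
      rw [hn'.1]
      exact sideTop_zero h0 h1.le hτσ (sideIn_of_mem_Ioo h00)
    have := (h _ 1 hσ' (Or.inl rfl) hz).of_map h0 h1.le hσ
      (by rw [mul_one]; exact neg_one_pow_eq_or ℝ n) hx0 hin
    rwa [mul_one, ← mul_neg_one, ← pow_succ] at this

/-- For `α = 0` rational numbers are not singularities of type B: the map fixes `-1`, and keeps its
sides, so that the averages on the right of `-1` cannot have a sign. -/
theorem not_isTypeB_zero {ξ : ℝ} (hξ : ξ ∈ Ico (0 - 1 : ℝ) 0) (hξQ : ξ ∈ range ((↑) : ℚ → ℝ)) :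
    ¬ IsTypeB (wilton 0) ξ := by
  intro hB
  obtain ⟨⟨a, b, hab, hint⟩, s, hs, hr, -⟩ := isTypeB_iff.mp hB
  have step : ∀ x s : ℝ, x ∈ Ico (0 - 1 : ℝ) 0 → (s = 1 ∨ s = -1) →
      IntegrableAtFilter (fun u => s * wilton 0 (x + 1 * u)) (𝓝[>] 0) volume →
      SideTop 0 x 1 s →
      IntegrableAtFilter (fun u => -s * wilton 0 (T 0 x + 1 * u)) (𝓝[>] 0) volume ∧
        SideTop 0 (T 0 x) 1 (-s) := by
    intro x s hx hs hi ht
    obtain ⟨h1, h2⟩ := ht.map (Or.inl rfl) hs hx.2.ne (sideIn_right hx) hi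
    have e : (-(1 * eps x) : ℝ) = 1 := by simp [eps_of_neg hx.2]
    rw [e] at h1 h2
    refine ⟨?_, h2⟩
    simp only [neg_mul]
    exact h1.neg
  have hall : ∀ k, ∃ s : ℝ, (s = 1 ∨ s = -1) ∧
      IntegrableAtFilter (fun u => s * wilton 0 ((T 0)^[k] ξ + 1 * u)) (𝓝[>] 0) volume ∧
      SideTop 0 ((T 0)^[k] ξ) 1 s := by
    intro k
    induction k with
    | zero => exact ⟨s, hs, integrableAt_side (Or.inl rfl) hab hint s, hr⟩
    | succ k ih =>
      obtain ⟨s, hs, hi, ht⟩ := ih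
      rw [Function.iterate_succ_apply']
      exact ⟨-s, by rcases hs with rfl | rfl <;> simp, step _ s (iterate_mem hξ k) hs hi ht⟩
  obtain ⟨r, rfl⟩ := hξQ
  obtain ⟨k, hk | hk⟩ := exists_iterate_eq ⟨le_rfl, zero_le_one⟩ _ _ hξ (denLE_of_rat r)
  · have := (iterate_mem hξ k).2
    rw [hk] at this
    exact lt_irrefl _ this
  · obtain ⟨s, hs, hi, ht⟩ := hall k
    rw [hk] at hi ht
    have h2 := (step (-1) s (by constructor <;> norm_num) hs hi ht).2
    have e : T 0 (-1) = -1 := by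
      rw [T_eq (c := 2)] <;> norm_num
    rw [e] at h2
    exact ht.not_neg h2

theorem isTypeB_of_avoids {α ξ : ℝ} (hα : α ∈ Icc (0 : ℝ) 1) (hξ : ξ ∈ Ico (α - 1) α)
    (hξQ : ξ ∈ range ((↑) : ℚ → ℝ)) (h : ∀ k, (T α)^[k] ξ ≠ α - 1) : IsTypeB (wilton α) ξ := by
  have h0 : 0 < α := by
    refine lt_of_le_of_ne hα.1 fun h0 => ?_
    subst h0
    obtain ⟨r, rfl⟩ := hξQ
    obtain ⟨k, hk | hk⟩ := exists_iterate_eq hα _ _ hξ (denLE_of_rat r)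
    · have := (iterate_mem hξ k).2
      rw [hk] at this
      exact lt_irrefl _ this
    · exact h k (by rw [hk]; norm_num)
  obtain ⟨k, hk⟩ := exists_firstZero (exists_iterate_eq_zero h0 hα.2 hξ hξQ)
  have h1 : α < 1 := by
    refine lt_of_le_of_ne hα.2 fun h1 => h k ?_
    rw [hk.1, h1, sub_self]
  have h00 : (0 : ℝ) ∈ Ioo (α - 1) α := ⟨by linarith, h0⟩
  refine isTypeB_of_iterate (s := 1) (k := k) h0 hα.2 (fun i hi => ?_) (Or.inl rfl) ?_ ?_
  · have hmem := iterate_mem hξ i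
    exact ⟨⟨lt_of_le_of_ne hmem.1 (h i).symm, hmem.2⟩, hk.2 i hi⟩
  · rw [hk.1]
    exact sideTop_zero h0 hα.2 (Or.inl rfl) (sideIn_of_mem_Ioo h00)
  · rw [hk.1]
    exact sideTop_zero h0 hα.2 (Or.inr rfl) (sideIn_of_mem_Ioo h00)

theorem isTypeA_one {ξ : ℝ} {k : ℕ}
    (hk : ∀ i < k, (T 1)^[i] ξ ∈ Ioo (1 - 1 : ℝ) 1 ∧ (T 1)^[i] ξ ≠ 0)
    (hk0 : (T 1)^[k] ξ = 1 - 1) : IsTypeA (wilton 1) ξ := by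
  have hin : SideIn 1 0 1 := by simpa using sideIn_left_endpoint 1
  have hr : SideTop 1 0 1 1 := sideTop_zero one_pos le_rfl (Or.inl rfl) hin
  have hl : SideTop 1 0 (-1) (-1) := by
    rw [← sideTop_add_int 1]
    have : (0 : ℝ) + ((1 : ℤ) : ℝ) = 1 := by norm_num
    rw [this]
    refine SideTop.of_map one_pos le_rfl (Or.inr rfl) (Or.inl rfl) one_ne_zero
      (sideIn_right_endpoint 1) ?_
    have e : T 1 1 = 0 := by rw [T_eq (c := 1)] <;> norm_num
    have e' : (-(-1 * eps 1) : ℝ) = 1 := by simp [eps_of_pos one_pos]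
    rw [e, e']
    exact hr
  refine isTypeA_of_iterate (k := k) one_pos le_rfl hk (Or.inl rfl) ?_ ?_
  · rwa [hk0, sub_self]
  · rwa [hk0, sub_self]

theorem singularity_of_hits {α ξ : ℝ} (hα : α ∈ Icc (0 : ℝ) 1) (hξ : ξ ∈ Ico (α - 1) α)
    (hξQ : ξ ∈ range ((↑) : ℚ → ℝ)) (hαQ : α ∈ range ((↑) : ℚ → ℝ))
    (h : ∃ k, (T α)^[k] ξ = α - 1) :
    (IsTypeB (wilton α) ξ ↔ InEvenMatchingInterval α) ∧
      (InOddMatchingInterval α → IsTypeA (wilton α) ξ) := by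
  classical
  rcases eq_or_lt_of_le hα.1 with rfl | h0
  · have hE : ∀ n m : ℕ, (0 : ℝ) ∉ matchingInterior n m := fun n m hm => lt_irrefl _ hm.1.1
    refine ⟨iff_of_false (not_isTypeB_zero hξ hξQ) ?_, fun hO => ?_⟩
    · rw [inEven_iff]
      rintro ⟨n, m, hm, -⟩
      exact hE n m hm
    · obtain ⟨n, m, hm, -⟩ := hO.exists
      exact (hE n m hm).elim
  obtain ⟨k, hk, hmin⟩ : ∃ k, (T α)^[k] ξ = α - 1 ∧ ∀ i < k, (T α)^[i] ξ ≠ α - 1 :=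
    ⟨Nat.find h, Nat.find_spec h, fun i hi => Nat.find_min h hi⟩
  have horb : ∀ i < k, (T α)^[i] ξ ∈ Ioo (α - 1) α ∧ (T α)^[i] ξ ≠ 0 := by
    intro i hi
    have hmem := iterate_mem hξ i
    refine ⟨⟨lt_of_le_of_ne hmem.1 (hmin i hi).symm, hmem.2⟩, fun hz => hmin i hi ?_⟩
    rw [hz, ← iterate_zero_of_le hz hi.le, hk]
  rcases eq_or_lt_of_le hα.2 with rfl | h1
  · have hA := isTypeA_one horb hk
    exact ⟨iff_of_false hA.not_isTypeB not_inEven_one, fun _ => hA⟩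
  have hn : ∃ n, FirstZero α α n := by
    obtain ⟨k, hk⟩ := exists_iterate_eq_zero h0 h1.le (T_mem (α := α) h0.ne') (T_rat hαQ)
    exact exists_firstZero ⟨k + 1, hk⟩
  have hm : ∃ m, FirstZero α (α - 1) m := by
    refine exists_firstZero (exists_iterate_eq_zero h0 h1.le ⟨le_rfl, by linarith⟩ ?_)
    obtain ⟨r, rfl⟩ := hαQ
    exact ⟨r - 1, by push_cast; rfl⟩
  obtain ⟨n, hn⟩ := hn
  obtain ⟨m, hm⟩ := hm
  have hr := sideTop_endpoint h0 h1 hαQ (Or.inr rfl) (Or.inl rfl) (sideIn_left_endpoint α) hm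
  have hl : SideTop α (α - 1) (-1) ((-1) ^ n) := by
    have := sideTop_endpoint h0 h1 hαQ (Or.inl rfl) (Or.inr rfl) (sideIn_right_endpoint α) hn
    rw [← sideTop_add_int 1]
    simpa using this
  rw [← hk] at hr hl
  have hA : Odd (n + m) → IsTypeA (wilton α) ξ := by
    intro ho
    refine isTypeA_of_iterate h0 h1.le horb (neg_one_pow_eq_or ℝ m) hr ?_
    have e : (-1 : ℝ) ^ n = -(-1) ^ m := by
      rcases Nat.even_or_odd m with hm | hm
      · have hn : Odd n := by rw [Nat.odd_add] at ho; exact ho.mpr hm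
        rw [hm.neg_one_pow, hn.neg_one_pow]
      · have hn : Even n := by rw [Nat.odd_add'] at ho; exact ho.mp hm
        rw [hm.neg_one_pow, hn.neg_one_pow, neg_neg]
    rwa [e] at hl
  refine ⟨?_, fun hO => hA (hO.odd_firstZero hn hm)⟩
  rw [inEven_iff_firstZero h0 h1 hn hm hαQ]
  constructor
  · intro hB
    by_contra hne
    exact (hA (Nat.not_even_iff_odd.mp hne)).not_isTypeB hB
  · intro he
    refine isTypeB_of_iterate h0 h1.le horb (neg_one_pow_eq_or ℝ m) hr ?_
    have e : (-1 : ℝ) ^ n = (-1) ^ m := by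
      rcases Nat.even_or_odd m with hm | hm
      · rw [hm.neg_one_pow, ((Nat.even_add.mp he).mpr hm).neg_one_pow]
      · have hn : Odd n := by
          rw [← Nat.not_even_iff_odd] at hm ⊢
          rwa [Nat.even_add.mp he]
        rw [hm.neg_one_pow, hn.neg_one_pow]
    rwa [e] at hl

end AlphaCF

end

theorem theorem3p3 (α ξ : ℝ) (hα : α ∈ Set.Icc (0 : ℝ) 1) (hξ : ξ ∈ Set.Ico (α - 1) α)
    (hξQ : ξ ∈ Set.range ((↑) : ℚ → ℝ)) :
    (({α, α - 1} ∩ {y : ℝ | ∃ k : ℕ, (AlphaCF.T α)^[k] ξ = y} = ∅) →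
        AlphaCF.IsTypeB (AlphaCF.wilton α) ξ) ∧
    (({α, α - 1} ∩ {y : ℝ | ∃ k : ℕ, (AlphaCF.T α)^[k] ξ = y} ≠ ∅) →
        α ∈ Set.range ((↑) : ℚ → ℝ) ∧
        (AlphaCF.IsTypeB (AlphaCF.wilton α) ξ ↔ AlphaCF.InEvenMatchingInterval α) ∧
        (AlphaCF.InOddMatchingInterval α → AlphaCF.IsTypeA (AlphaCF.wilton α) ξ)) := by
  constructor
  · intro h
    refine AlphaCF.isTypeB_of_avoids hα hξ hξQ fun k hk => ?_
    have : α - 1 ∈ ({α, α - 1} ∩ {y : ℝ | ∃ k : ℕ, (AlphaCF.T α)^[k] ξ = y} : Set ℝ) :=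
      ⟨Or.inr rfl, k, hk⟩
    rw [h] at this
    exact this
  · intro h
    obtain ⟨y, hy, k, hk⟩ := Set.nonempty_iff_ne_empty.mpr h
    have hmem := AlphaCF.iterate_mem hξ k
    have hy1 : y = α - 1 := by
      rcases hy with rfl | hy
      · rw [hk] at hmem
        exact (lt_irrefl _ hmem.2).elim
      · exact hy
    subst hy1
    have hαQ : α ∈ Set.range ((↑) : ℚ → ℝ) := by
      obtain ⟨r, hr⟩ := AlphaCF.iterate_rat (α := α) hξQ k
      rw [hk] at hr
      exact ⟨r + 1, by push_cast; linarith⟩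
    exact ⟨hαQ, AlphaCF.singularity_of_hits hα hξ hξQ hαQ ⟨k, hk⟩⟩
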